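/- **Theorem.** Consider the quantum general graph model: the input is a simple graph $G=(V,E)$ on $V=[n]$, $n\ge 1$, together with an arbitrary ordering of the neighbors of each vertex, and an algorithm may apply the unitaries $|v\rangle|b\rangle\mapsto|v\rangle|b\oplus d_v\rangle$ (degree query), $|v\rangle|i\rangle|b\rangle\mapsto|v\rangle|i\rangle|b\oplus N(v,i)\rangle$ (neighbor query, where $N(v,i)$ is the $i$-th neighbor of $v$ if $i\le d_v$ and $\bot$ otherwise) and $|u\rangle|v\rangle|b\rangle\mapsto|u\rangle|v\rangle|b\oplus[uv\in E]\rangle$ (vertex-pair query), as well as unitaries and measurements that do not depend on the input, with classical control by the measurement outcomes. The query complexity counts the queries only, and the algorithm may depend on $n$ and $\epsilon$, but not on $G$ or on its number of edges. There are absolute constants $C$ and $c$ such that, for every $n\ge 1$ and every $0<\epsilon<1$, there is a quantum query algorithm that uses no vertex-pair query and has the following property. For every $n$-vertex graph $G$ with $m$ edges, and every ordering of its adjacency lists, it outputs a real number $\widetilde m$ such that $$|\widetilde m-m|\le \epsilon m \quad\text{with probability at least } 2/3,$$ and the expected number of (degree and neighbor) queries that it performs on $G$ is at most $$C\,x\,(1+\ln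 x)^{c},\qquad x=\frac{n^{1/2}}{\epsilon\,\max(m,1)^{1/4}},$$ that is, it performs $\widetilde O\bigl(n^{1/2}/(\epsilon m^{1/4})\bigr)$ queries in expectation, where $\widetilde O(x)$ stands for $O(x\cdot\operatorname{polylog} x)$. -/

import Mathlib

/-! ## The quantum general graph model

Graphs are simple graphs on the vertex set `Fin n`. Besides the graph, the input fixes the order
in which the neighbors of each vertex are listed; this order is arbitrary. -/

/-- An adjacency-list representation of `G`: for every vertex, an enumeration of its neighbors. -/
abbrev NeighborOrder {n : ℕ} (G : SimpleGraph (Fin n)) [DecidableRel G.Adj] : Type :=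
  (v : Fin n) → Fin (G.degree v) ≃ G.neighborSet v

/-- Answer to the neighbor query `(v, i)`, where positions are numbered from `0`: the neighbor of
`v` in position `i` if `i < d_v`, and otherwise the symbol `⊥`, which is encoded by the number `n`
(vertices are encoded by `0, …, n - 1`). -/
def neighborAnswer {n : ℕ} {G : SimpleGraph (Fin n)} [DecidableRel G.Adj]
    (L : NeighborOrder G) (v i : Fin n) : ℕ :=
  if h : (i : ℕ) < G.degree v then ((L v ⟨i, h⟩ : Fin n) : ℕ) else n

/-- Bit strings of length `k`. -/
abbrev Bits (k : ℕ) : Type := Fin k → Bool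

/-- The bitwise exclusive or `b ⊕ a` of a bit string and (the low-order bits of) a number. -/
def Bits.xorNat {k : ℕ} (b : Bits k) (a : ℕ) : Bits k := fun j => xor (b j) (a.testBit j)

theorem Bits.xorNat_xorNat {k : ℕ} (b : Bits k) (a : ℕ) : (b.xorNat a).xorNat a = b := by
  funext j; simp [Bits.xorNat]

/-- Labels of the computational basis. The registers are: a vertex; a second argument (a position
in an adjacency list, or a second vertex); the answer registers of the degree queries
(`⌈log₂ n⌉` bits), of the neighbor queries (`⌈log₂ (n + 1)⌉` bits) and of the vertex-pair queries
(one bit); and a workspace `W`. -/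
abbrev BasisLabel (n : ℕ) (W : Type) : Type :=
  Fin n × Fin n × Bits (Nat.clog 2 n) × Bits (Nat.clog 2 (n + 1)) × Bool × W

/-- The Hilbert space of the algorithm. -/
abbrev QState (n : ℕ) (W : Type) : Type := EuclideanSpace ℂ (BasisLabel n W)

section Oracles

variable {n : ℕ} (G : SimpleGraph (Fin n)) [DecidableRel G.Adj] (L : NeighborOrder G) (W : Type)

/-- `|v⟩|b⟩ ↦ |v⟩|b ⊕ d_v⟩`, as a permutation of the computational basis. -/
def degreePerm : Equiv.Perm (BasisLabel n W) :=
  Function.Involutive.toPerm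
    (fun x => match x with
      | (v, i, b, c, p, w) => (v, i, b.xorNat (G.degree v), c, p, w))
    (by rintro ⟨v, i, b, c, p, w⟩; simp [Bits.xorNat_xorNat])

/-- `|v⟩|i⟩|c⟩ ↦ |v⟩|i⟩|c ⊕ (i-th neighbor of v, or ⊥)⟩`, as a permutation of the computational
basis. -/
def neighborPerm : Equiv.Perm (BasisLabel n W) :=
  Function.Involutive.toPerm
    (fun x => match x with
      | (v, i, b, c, p, w) => (v, i, b, c.xorNat (neighborAnswer L v i), p, w))
    (by rintro ⟨v, i, b, c, p, w⟩; simp [Bits.xorNat_xorNat])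

/-- `|u⟩|v⟩|p⟩ ↦ |u⟩|v⟩|p ⊕ [uv ∈ E]⟩`, as a permutation of the computational basis. -/
def pairPerm : Equiv.Perm (BasisLabel n W) :=
  Function.Involutive.toPerm
    (fun x => match x with
      | (u, v, b, c, p, w) => (u, v, b, c, xor p (decide (G.Adj u v)), w))
    (by rintro ⟨u, v, b, c, p, w⟩; simp)

end Oracles

/-- The unitary that maps each basis vector `|x⟩` to `|σ x⟩`. -/
noncomputable def permUnitary {n : ℕ} {W : Type} [Fintype W]
    (σ : Equiv.Perm (BasisLabel n W)) : QState n W ≃ₗᵢ[ℂ] QState n W :=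
  LinearIsometryEquiv.piLpCongrLeft 2 ℂ ℂ σ

/-- The (unnormalized) state after the basis measurement of the function `f` of the basis label
has given the outcome `o`. -/
noncomputable def measureProj {n : ℕ} {W : Type} {k : ℕ} (f : BasisLabel n W → Fin k) (o : Fin k)
    (ψ : QState n W) : QState n W :=
  WithLp.toLp 2 fun x => if f x = o then ψ x else 0

/-- Quantum query programs with intermediate measurements and classical control. Apart from the
queries, nothing in a program has access to the input graph. -/
inductive QProg (n : ℕ) (W : Type) [Fintype W] : Type
  /-- stop and output `r` -/
  | output (r : ℝ) : QProg n W
  /-- apply a fixed unitary to the whole memory -/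
  | unitary (U : QState n W ≃ₗᵢ[ℂ] QState n W) (next : QProg n W) : QProg n W
  /-- one quantum degree query -/
  | degreeQuery (next : QProg n W) : QProg n W
  /-- one quantum neighbor query -/
  | neighborQuery (next : QProg n W) : QProg n W
  /-- one quantum vertex-pair query -/
  | pairQuery (next : QProg n W) : QProg n W
  /-- measure a function of the basis label, and continue according to the outcome -/
  | measure {k : ℕ} (f : BasisLabel n W → Fin k) (next : Fin k → QProg n W) : QProg n W

namespace QProg

variable {n : ℕ} {W : Type} [Fintype W]

/-- The expectation of `g (output) (number of queries)` when the program is run on the graph `G`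
from the state `ψ`. States are not renormalized after a measurement, so that the squared norm of
the current state is the probability of the current branch. -/
noncomputable def expectation (G : SimpleGraph (Fin n)) [DecidableRel G.Adj]
    (L : NeighborOrder G) : QProg n W → (g : ℝ → ℕ → ℝ) → QState n W → ℝ
  | output r, g, ψ => ‖ψ‖ ^ 2 * g r 0
  | unitary U next, g, ψ => expectation G L next g (U ψ)
  | degreeQuery next, g, ψ =>
      expectation G L next (fun r q => g r (q + 1)) (permUnitary (degreePerm G W) ψ)
  | neighborQuery next, g, ψ =>
      expectation G L next (fun r q => g r (q + 1)) (permUnitary (neighborPerm G L W) ψ)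
  | pairQuery next, g, ψ =>
      expectation G L next (fun r q => g r (q + 1)) (permUnitary (pairPerm G W) ψ)
  | measure f next, g, ψ => ∑ o, expectation G L (next o) g (measureProj f o ψ)

/-- The program contains no vertex-pair query. -/
def PairFree : QProg n W → Prop
  | output _ => True
  | unitary _ next => next.PairFree
  | degreeQuery next => next.PairFree
  | neighborQuery next => next.PairFree
  | pairQuery _ => False
  | measure _ next => ∀ o, (next o).PairFree

end QProg

/-- A quantum query algorithm for graphs on `n` vertices: a finite workspace, an initial basis
state, and a program. -/
structure QueryAlgorithm (n : ℕ) where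
  /-- the workspace register -/
  W : Type
  [fintypeW : Fintype W]
  /-- the label of the initial basis state -/
  init : BasisLabel n W
  /-- the program -/
  prog : QProg n W

namespace QueryAlgorithm

attribute [instance] QueryAlgorithm.fintypeW

variable {n : ℕ} (A : QueryAlgorithm n) (G : SimpleGraph (Fin n)) [DecidableRel G.Adj]
  (L : NeighborOrder G)

open Classical in
/-- The initial state `|init⟩`. -/
noncomputable def initState : QState n A.W := EuclideanSpace.single A.init 1

open Classical in
/-- The probability that the output of the algorithm lies in `S`. -/
noncomputable def probOutput (S : Set ℝ) : ℝ :=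
  A.prog.expectation G L (fun r _ => if r ∈ S then 1 else 0) A.initState

/-- The expected number of queries (of all kinds). -/
noncomputable def expectedQueries : ℝ :=
  A.prog.expectation G L (fun _ q => (q : ℝ)) A.initState

end QueryAlgorithm

/-- The quantity `n^{1/2} / (ε m^{1/4})`; for an edgeless graph, `m` is replaced by `1`. -/
noncomputable def edgeRate (n m : ℕ) (ε : ℝ) : ℝ :=
  (n : ℝ) ^ (1 / 2 : ℝ) / (ε * (max m 1 : ℝ) ^ (1 / 4 : ℝ))

/-! Direct every edge towards its endpoint of larger degree, ties broken by vertex number, so that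
it is counted once, at its lower endpoint. At most `4 m² / K²` edges have a lower endpoint of degree
at least `K`, since both endpoints are among the at most `2 m / K` vertices of such degree
(`sq_mul_card_orderedEdges_le`). With `D` of order `√m`, the edges whose lower endpoint has degree
above order `D / ε` can therefore be dropped, and the others are sorted into `O(log (1/ε))` dyadic
ranges of that degree. Up to degree `2^i D` there are `n 2^i D` pairs of a vertex and a list
position to search, but the number of edges in the range falls fast enough that the product of both
numbers stays `O(n m^{3/2})`. One accuracy `κ` of order `ε m^{1/4} / n^{1/2}`, up to logarithms,
thus serves all ranges (`success_levels_round`).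

Each count is made by amplitude estimation at cost `O(1/κ)`. The counter starts in a triangular
window; by Parseval, the second moment of the sine of the phase error is a quarter of the energy of
the differences of the window (`sum_norm_sq_counterFourier_mul_sin_sq`), and Chebyshev's inequality
gives the tail bound `outcomeProb_estimationCircuit_le`.

As `m` is unknown, guesses `n² / 16^r` are tried in decreasing order. A guess is tested by
estimating the sum of the degrees truncated near `n / 4^r`: this sum is at most `2 m`, and it is at
least `m` or at least `2 D²` (`le_truncatedDegreeSum`). Accurate tests stop at a guess within a
constant factor of `m`. The failure probabilities of the tests telescope (`success_rounds`). Once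
the guess is small enough, a further round is reached with probability at most `1/12`, while the
round cost grows by a factor of at most `4`, so the expected cost is dominated by the right round
(`queries_rounds_late`). -/

/-! ## Circuits and sampling from their output distribution -/

/-- The gates of an algorithm without vertex-pair queries. -/
inductive Gate (n : ℕ) (W : Type) [Fintype W] : Type
  /-- a fixed unitary -/
  | fixed (U : QState n W ≃ₗᵢ[ℂ] QState n W) : Gate n W
  /-- a degree query -/
  | degree : Gate n W
  /-- a neighbor query -/
  | neighbor : Gate n W

namespace Gate

variable {n : ℕ} {W : Type} [Fintype W]

/-- The unitary that a gate performs on the input graph. -/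
noncomputable def apply (G : SimpleGraph (Fin n)) [DecidableRel G.Adj] (L : NeighborOrder G) :
    Gate n W → QState n W ≃ₗᵢ[ℂ] QState n W
  | fixed U => U
  | degree => permUnitary (degreePerm G W)
  | neighbor => permUnitary (neighborPerm G L W)

/-- The number of queries of a gate. -/
def cost : Gate n W → ℕ
  | fixed _ => 0
  | degree => 1
  | neighbor => 1

/-- Prepend a gate to a program. -/
def prepend : Gate n W → QProg n W → QProg n W
  | fixed U, P => .unitary U P
  | degree, P => .degreeQuery P
  | neighbor, P => .neighborQuery P

/-- The unitary that a list of gates performs. -/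
noncomputable def runList (G : SimpleGraph (Fin n)) [DecidableRel G.Adj] (L : NeighborOrder G)
    (gs : List (Gate n W)) (ψ : QState n W) : QState n W :=
  gs.foldl (fun φ g => g.apply G L φ) ψ

/-- The number of queries of a list of gates. -/
def listCost (gs : List (Gate n W)) : ℕ := (gs.map cost).sum

/-- Prepend a list of gates to a program. -/
def prependList (gs : List (Gate n W)) (P : QProg n W) : QProg n W := gs.foldr prepend P

theorem pairFree_prependList (gs : List (Gate n W)) {P : QProg n W} (hP : P.PairFree) :
    (prependList gs P).PairFree := by
  induction gs with
  | nil => exact hP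
  | cons g gs ih => cases g <;> exact ih

variable (G : SimpleGraph (Fin n)) [DecidableRel G.Adj] (L : NeighborOrder G)

theorem norm_runList (gs : List (Gate n W)) (ψ : QState n W) : ‖runList G L gs ψ‖ = ‖ψ‖ := by
  induction gs generalizing ψ with
  | nil => rfl
  | cons g gs ih =>
    change ‖runList G L gs (g.apply G L ψ)‖ = _
    rw [ih, LinearIsometryEquiv.norm_map]

theorem expectation_prependList (gs : List (Gate n W)) (P : QProg n W) (g : ℝ → ℕ → ℝ)
    (ψ : QState n W) :
    (prependList gs P).expectation G L g ψ =
      P.expectation G L (fun r q => g r (q + listCost gs)) (runList G L gs ψ) := by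
  induction gs generalizing g ψ with
  | nil => rfl
  | cons a gs ih =>
    have h : (prependList (a :: gs) P).expectation G L g ψ =
        (prependList gs P).expectation G L (fun r q => g r (q + a.cost)) (a.apply G L ψ) := by
      cases a <;> rfl
    rw [h, ih]
    have h2 : listCost (a :: gs) = a.cost + listCost gs := by simp [listCost]
    simp only [h2, Nat.add_assoc, Nat.add_comm (listCost gs)]
    rfl

end Gate

/-! ### Expectations under measurement, and classical mixtures of runs. -/

namespace QProg

variable {n : ℕ} {W : Type} [Fintype W] (G : SimpleGraph (Fin n)) [DecidableRel G.Adj]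
  (L : NeighborOrder G)

omit [Fintype W] in
theorem measureProj_smul {k : ℕ} (f : BasisLabel n W → Fin k) (o : Fin k) (c : ℂ)
    (ψ : QState n W) : measureProj f o (c • ψ) = c • measureProj f o ψ := by
  ext x; simp [measureProj]

theorem sum_norm_sq_measureProj {k : ℕ} (f : BasisLabel n W → Fin k) (ψ : QState n W) :
    ∑ o, ‖measureProj f o ψ‖ ^ 2 = ‖ψ‖ ^ 2 := by
  simp only [EuclideanSpace.norm_sq_eq]
  rw [Finset.sum_comm]
  refine Finset.sum_congr rfl fun x _ => ?_
  rw [Finset.sum_eq_single (f x)]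
  · simp [measureProj]
  · intro o _ ho; simp [measureProj, ho.symm]
  · simp

theorem expectation_smul (P : QProg n W) (g : ℝ → ℕ → ℝ) (c : ℂ) (ψ : QState n W) :
    P.expectation G L g (c • ψ) = ‖c‖ ^ 2 * P.expectation G L g ψ := by
  induction P generalizing g ψ with
  | output r => simp only [expectation, norm_smul]; ring
  | unitary U P ih => simp only [expectation, map_smul, ih]
  | degreeQuery P ih => simp only [expectation, map_smul, ih]
  | neighborQuery P ih => simp only [expectation, map_smul, ih]
  | pairQuery P ih => simp only [expectation, map_smul, ih]
  | measure f P ih => simp only [expectation, measureProj_smul, ih, Finset.mul_sum]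

/-- The branches of a measurement share out the squared norm, so a constant payoff collects exactly
the initial mass. This takes the cost of a circuit out of the count of queries. -/
theorem expectation_add_const (P : QProg n W) (g : ℝ → ℕ → ℝ) (c : ℝ) (ψ : QState n W) :
    P.expectation G L (fun r q => g r q + c) ψ = P.expectation G L g ψ + c * ‖ψ‖ ^ 2 := by
  induction P generalizing g ψ with
  | output r => simp only [expectation]; ring
  | unitary U P ih => simp only [expectation, ih, LinearIsometryEquiv.norm_map]
  | degreeQuery P ih =>
    have := ih (fun r q => g r (q + 1)); simp only [expectation, this, LinearIsometryEquiv.norm_map]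
  | neighborQuery P ih =>
    have := ih (fun r q => g r (q + 1)); simp only [expectation, this, LinearIsometryEquiv.norm_map]
  | pairQuery P ih =>
    have := ih (fun r q => g r (q + 1)); simp only [expectation, this, LinearIsometryEquiv.norm_map]
  | measure f P ih =>
    simp only [expectation, ih, Finset.sum_add_distrib, ← Finset.mul_sum, sum_norm_sq_measureProj]

theorem expectation_nonneg (P : QProg n W) (g : ℝ → ℕ → ℝ) (hg : ∀ r q, 0 ≤ g r q)
    (ψ : QState n W) : 0 ≤ P.expectation G L g ψ := by
  induction P generalizing g ψ with
  | output r => exact mul_nonneg (sq_nonneg _) (hg _ _)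
  | unitary U P ih => exact ih _ hg _
  | degreeQuery P ih => exact ih _ (fun _ _ => hg _ _) _
  | neighborQuery P ih => exact ih _ (fun _ _ => hg _ _) _
  | pairQuery P ih => exact ih _ (fun _ _ => hg _ _) _
  | measure f P ih => exact Finset.sum_nonneg fun o _ => ih o _ hg _

open Classical in
/-- The computational basis state `|x⟩`. -/
noncomputable def basisState (x : BasisLabel n W) : QState n W :=
  WithLp.toLp 2 fun y => if y = x then 1 else 0

theorem norm_basisState (x : BasisLabel n W) : ‖basisState x‖ = 1 := by
  have : ‖basisState x‖ ^ 2 = 1 := by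
    rw [EuclideanSpace.norm_sq_eq, Finset.sum_eq_single x] <;> simp +contextual [basisState]
  exact (pow_eq_one_iff_of_nonneg (norm_nonneg _) two_ne_zero).1 this

theorem permUnitary_apply (σ : Equiv.Perm (BasisLabel n W)) (ψ : QState n W)
    (x : BasisLabel n W) : permUnitary σ ψ x = ψ (σ.symm x) := rfl

open Classical in
/-- Run a circuit, measure all registers, reset the memory to `|init⟩`, and continue according to
the outcome. -/
noncomputable def sampleThen (init : BasisLabel n W) (gs : List (Gate n W))
    (next : BasisLabel n W → QProg n W) : QProg n W :=
  Gate.prependList gs (.measure (Fintype.equivFin (BasisLabel n W)) fun o =>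
    .unitary (permUnitary (Equiv.swap ((Fintype.equivFin (BasisLabel n W)).symm o) init))
      (next ((Fintype.equivFin (BasisLabel n W)).symm o)))

theorem pairFree_sampleThen {init : BasisLabel n W} {gs : List (Gate n W)}
    {next : BasisLabel n W → QProg n W} (h : ∀ x, (next x).PairFree) :
    (sampleThen init gs next).PairFree :=
  Gate.pairFree_prependList _ fun _ => h _

/-- Measuring every register leaves a multiple of one basis state, and the swap of `x` and `init`
turns it into a multiple of `basisState init`. Expectations are quadratic in the state
(`expectation_smul`), so the run is a classical mixture of fresh starts and composes by ordinary
probability. -/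
theorem expectation_sampleThen (init : BasisLabel n W) (gs : List (Gate n W))
    (next : BasisLabel n W → QProg n W) (g : ℝ → ℕ → ℝ) (ψ : QState n W) :
    (sampleThen init gs next).expectation G L g ψ =
      ∑ x, ‖Gate.runList G L gs ψ x‖ ^ 2 *
        (next x).expectation G L (fun r q => g r (q + Gate.listCost gs)) (basisState init) := by
  classical
  rw [sampleThen, Gate.expectation_prependList]
  simp only [expectation]
  rw [← Equiv.sum_comp (Fintype.equivFin (BasisLabel n W))]
  refine Finset.sum_congr rfl fun x _ => ?_
  rw [← expectation_smul]
  have : ∀ φ : QState n W, permUnitary (Equiv.swap x init)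
      (measureProj (Fintype.equivFin (BasisLabel n W)) (Fintype.equivFin (BasisLabel n W) x) φ)
      = φ x • basisState init := by
    intro φ
    ext y
    rw [permUnitary_apply]
    simp only [measureProj, EmbeddingLike.apply_eq_iff_eq, Equiv.symm_swap,
      PiLp.smul_apply, basisState, smul_eq_mul, mul_ite, mul_one, mul_zero]
    by_cases hy : y = init
    · subst hy; simp
    · have : Equiv.swap x init y ≠ x := by
        intro h; apply hy; rw [← Equiv.swap_apply_left x init] at h
        exact (Equiv.swap x init).injective (by simpa using h)
      simp [hy, this]
  simp only [Equiv.symm_apply_apply, this]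

/-- The probability that the output lies in `S`, when the program starts in `|init⟩`. -/
noncomputable def success (init : BasisLabel n W) (S : Set ℝ) (P : QProg n W) : ℝ :=
  open Classical in P.expectation G L (fun r _ => if r ∈ S then 1 else 0) (basisState init)

/-- The expected number of queries, when the program starts in `|init⟩`. -/
noncomputable def queries (init : BasisLabel n W) (P : QProg n W) : ℝ :=
  P.expectation G L (fun _ q => (q : ℝ)) (basisState init)

/-- The probability that the outcome of the measurement after a circuit is in `B`. -/
noncomputable def outcomeProb (init : BasisLabel n W) (gs : List (Gate n W))
    (B : BasisLabel n W → Prop) : ℝ :=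
  open Classical in ∑ x with B x, ‖Gate.runList G L gs (basisState init) x‖ ^ 2

variable {G L}

theorem success_nonneg (init : BasisLabel n W) (S : Set ℝ) (P : QProg n W) :
    0 ≤ success G L init S P :=
  expectation_nonneg _ _ _ _ (fun _ _ => by split_ifs <;> norm_num) _

theorem queries_nonneg (init : BasisLabel n W) (P : QProg n W) :
    0 ≤ queries G L init P :=
  expectation_nonneg _ _ _ _ (fun _ _ => by positivity) _

theorem sum_norm_sq_runList (init : BasisLabel n W) (gs : List (Gate n W)) :
    ∑ x, ‖Gate.runList G L gs (basisState init) x‖ ^ 2 = 1 := by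
  rw [← EuclideanSpace.norm_sq_eq, Gate.norm_runList, norm_basisState, one_pow]

theorem success_output {init : BasisLabel n W} {S : Set ℝ} {r : ℝ} (h : r ∈ S) :
    success G L init S (.output r) = 1 := by
  simp [success, expectation, h, norm_basisState]

theorem queries_output {init : BasisLabel n W} {r : ℝ} :
    queries G L init (.output r) = 0 := by
  simp [queries, expectation]

/-- A union bound: the outcomes outside `B` have mass at least `1 - δ`, and the contribution of `B`
is nonnegative. -/
theorem success_sampleThen {init : BasisLabel n W} {S : Set ℝ} {gs : List (Gate n W)}
    {next : BasisLabel n W → QProg n W} (B : BasisLabel n W → Prop) {δ w : ℝ} (hw : 0 ≤ w)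
    (hB : outcomeProb G L init gs B ≤ δ)
    (h : ∀ x, ¬ B x → 1 - w ≤ success G L init S (next x)) :
    1 - δ - w ≤ success G L init S (sampleThen init gs next) := by
  classical
  have key : success G L init S (sampleThen init gs next) =
      ∑ x, ‖Gate.runList G L gs (basisState init) x‖ ^ 2 * success G L init S (next x) :=
    expectation_sampleThen _ _ _ _ _ _ _
  have hsum := sum_norm_sq_runList (G := G) (L := L) init gs
  rw [← Finset.sum_filter_add_sum_filter_not _ B] at hsum
  rw [key, ← Finset.sum_filter_add_sum_filter_not _ B]
  have h0 : 0 ≤ ∑ x with B x,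
      ‖Gate.runList G L gs (basisState init) x‖ ^ 2 * success G L init S (next x) :=
    Finset.sum_nonneg fun x _ => mul_nonneg (sq_nonneg _) (success_nonneg _ _ _)
  have h1 : (∑ x with ¬ B x, ‖Gate.runList G L gs (basisState init) x‖ ^ 2) * (1 - w) ≤
      ∑ x with ¬ B x,
      ‖Gate.runList G L gs (basisState init) x‖ ^ 2 * success G L init S (next x) := by
    rw [Finset.sum_mul]
    exact Finset.sum_le_sum fun x hx =>
      mul_le_mul_of_nonneg_left (h x (Finset.mem_filter.1 hx).2) (sq_nonneg _)
  have h2 : outcomeProb G L init gs B =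
    ∑ x with B x, ‖Gate.runList G L gs (basisState init) x‖ ^ 2 := rfl
  have h3 : 0 ≤ ∑ x with B x, ‖Gate.runList G L gs (basisState init) x‖ ^ 2 :=
    Finset.sum_nonneg fun x _ => sq_nonneg _
  nlinarith

/-- The surplus `c₁` is paid only on bad outcomes, hence with weight at most `δ`. This average
controls the cost of overshooting the right round. -/
theorem queries_sampleThen {init : BasisLabel n W} {gs : List (Gate n W)}
    {next : BasisLabel n W → QProg n W} (B : BasisLabel n W → Prop) {δ c₀ c₁ : ℝ}
    (hc₁ : 0 ≤ c₁) (hB : outcomeProb G L init gs B ≤ δ)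
    (h : ∀ x, ¬ B x → queries G L init (next x) ≤ c₀)
    (h' : ∀ x, B x → queries G L init (next x) ≤ c₀ + c₁) :
    queries G L init (sampleThen init gs next) ≤ Gate.listCost gs + c₀ + δ * c₁ := by
  classical
  have key : queries G L init (sampleThen init gs next) =
      ∑ x, ‖Gate.runList G L gs (basisState init) x‖ ^ 2 *
        (queries G L init (next x) + Gate.listCost gs) := by
    rw [queries, expectation_sampleThen]
    refine Finset.sum_congr rfl fun x _ => ?_
    have := expectation_add_const G L (next x) (fun _ q => (q : ℝ)) (Gate.listCost gs)
      (basisState init)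
    simp only [Nat.cast_add, this, norm_basisState, queries, one_pow, mul_one]
  have hsum := sum_norm_sq_runList (G := G) (L := L) init gs
  have h1 : ∀ x, ‖Gate.runList G L gs (basisState init) x‖ ^ 2 *
        (queries G L init (next x) + Gate.listCost gs) ≤
        ‖Gate.runList G L gs (basisState init) x‖ ^ 2 * (Gate.listCost gs + c₀) +
        if B x then ‖Gate.runList G L gs (basisState init) x‖ ^ 2 * c₁ else 0 := by
    intro x
    split_ifs with hx
    · rw [← mul_add]
      exact mul_le_mul_of_nonneg_left (by linarith [h' x hx]) (sq_nonneg _)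
    · rw [add_zero]
      exact mul_le_mul_of_nonneg_left (by linarith [h x hx]) (sq_nonneg _)
  rw [key]
  refine (Finset.sum_le_sum fun x _ => h1 x).trans ?_
  rw [Finset.sum_add_distrib, ← Finset.sum_mul, hsum, ← Finset.sum_filter, ← Finset.sum_mul,
    one_mul]
  have : outcomeProb G L init gs B * c₁ ≤ δ * c₁ := mul_le_mul_of_nonneg_right hB hc₁
  exact add_le_add le_rfl this

end QProg

theorem QueryAlgorithm.initState_eq {n : ℕ} (A : QueryAlgorithm n) :
    A.initState = QProg.basisState A.init := by
  classical
  ext y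
  simp [QueryAlgorithm.initState, QProg.basisState]

/-! ## Unitaries on parts of the memory -/

section Unitaries

variable {n : ℕ} {W : Type} [Fintype W]

/-- Change the sign of the amplitudes of the labels that satisfy `f`. -/
noncomputable def signUnitary (f : BasisLabel n W → Prop) : QState n W ≃ₗᵢ[ℂ] QState n W :=
  open Classical in LinearIsometryEquiv.piLpCongrRight 2 fun x =>
    if f x then LinearIsometryEquiv.neg ℂ else LinearIsometryEquiv.refl ℂ ℂ

open Classical in
theorem signUnitary_apply (f : BasisLabel n W → Prop) (ψ : QState n W) (x : BasisLabel n W) :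
    signUnitary f ψ x = if f x then -ψ x else ψ x := by
  simp only [signUnitary, LinearIsometryEquiv.piLpCongrRight_apply]
  split_ifs <;> simp

/-- Apply a unitary to the second component of the labels, under the control of the first. -/
noncomputable def blockUnitary {A B : Type} [Fintype A] [Fintype B] (e : BasisLabel n W ≃ A × B)
    (U : A → EuclideanSpace ℂ B ≃ₗᵢ[ℂ] EuclideanSpace ℂ B) : QState n W ≃ₗᵢ[ℂ] QState n W :=
  ((LinearIsometryEquiv.piLpCongrLeft 2 ℂ ℂ (e.trans (Equiv.sigmaEquivProd A B).symm)).trans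
    ((LinearIsometryEquiv.piLpCurry ℂ 2 fun (_ : A) (_ : B) => ℂ).trans
      (LinearIsometryEquiv.piLpCongrRight 2 U))).trans
  ((LinearIsometryEquiv.piLpCongrLeft 2 ℂ ℂ (e.trans (Equiv.sigmaEquivProd A B).symm)).trans
    (LinearIsometryEquiv.piLpCurry ℂ 2 fun (_ : A) (_ : B) => ℂ)).symm

theorem blockUnitary_apply {A B : Type} [Fintype A] [Fintype B] (e : BasisLabel n W ≃ A × B)
    (U : A → EuclideanSpace ℂ B ≃ₗᵢ[ℂ] EuclideanSpace ℂ B) (ψ : QState n W)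
    (x : BasisLabel n W) :
    blockUnitary e U ψ x =
      U (e x).1 (WithLp.toLp 2 fun b => ψ (e.symm ((e x).1, b))) (e x).2 := by
  simp [blockUnitary, LinearIsometryEquiv.piLpCongrLeft_apply, LinearIsometryEquiv.piLpCongrLeft_symm]
  rfl

theorem exists_unitary_map_basisState (init : BasisLabel n W) (ψ : QState n W) (h : ‖ψ‖ = 1) :
    ∃ U : QState n W ≃ₗᵢ[ℂ] QState n W, U (QProg.basisState init) = ψ := by
  classical
  obtain ⟨b, hb⟩ := Orthonormal.exists_orthonormalBasis_extension_of_card_eq (𝕜 := ℂ)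
    (E := QState n W) (ι := BasisLabel n W) (by simp) (v := fun _ => ψ) (s := {init})
    (by
      constructor
      · intro i; exact h
      · intro i j hij; exact absurd (Subsingleton.elim i j) hij)
  refine ⟨(EuclideanSpace.basisFun (BasisLabel n W) ℂ).equiv b (Equiv.refl _), ?_⟩
  have h1 : QProg.basisState init = EuclideanSpace.basisFun (BasisLabel n W) ℂ init := by
    ext y; simp [QProg.basisState]
  rw [h1, OrthonormalBasis.equiv_apply_basis]
  exact hb init rfl

end Unitaries

/-! ## A phase oracle -/

/-- The workspace: a counter, a vertex, and a degree. -/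
abbrev Workspace (n N : ℕ) : Type := Fin N × Fin n × Bits (Nat.clog 2 n)

/-- A predicate on a vertex `v`, a position `i`, the degree of `v`, the neighbor of `v` in
position `i`, and the degree of this neighbor. -/
abbrev Marker (n : ℕ) : Type := Fin n → Fin n → ℕ → Fin n → ℕ → Prop

section Oracle

variable {n N : ℕ}

/-- The vertex with the binary encoding `c`, and `z` if there is none. -/
def decodeVertex (z : Fin n) {k : ℕ} (c : Bits k) : Fin n :=
  if h : Nat.ofBits c < n then ⟨Nat.ofBits c, h⟩ else z

/-- The zero bit string. -/
def Bits.zero (k : ℕ) : Bits k := fun _ => false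

theorem Bits.ofBits_xorNat_zero {k a : ℕ} (h : a < 2 ^ k) :
    Nat.ofBits ((Bits.zero k).xorNat a) = a := by
  have : (Bits.zero k).xorNat a = fun j : Fin k => a.testBit j := by
    funext j; simp [Bits.xorNat, Bits.zero]
  rw [this, Nat.ofBits_testBit, Nat.mod_eq_of_lt h]

/-- Save the vertex and the degree in the workspace, and move the neighbor to the vertex
register. -/
def shufflePerm (z : Fin n) : Equiv.Perm (BasisLabel n (Workspace n N)) where
  toFun := fun (v, i, b, c, p, (k, a, e)) =>
    (Equiv.swap z (decodeVertex z c) a, i, e, c, p, (k, v, b))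
  invFun := fun (v, i, b, c, p, (k, a, e)) =>
    (a, i, e, c, p, (k, Equiv.swap z (decodeVertex z c) v, b))
  left_inv := by rintro ⟨v, i, b, c, p, k, a, e⟩; simp
  right_inv := by rintro ⟨v, i, b, c, p, k, a, e⟩; simp

/-- The circuit that changes the sign of the marked labels with counter larger than `t`. -/
noncomputable def phaseCircuit (z : Fin n) (F : Marker n) (t : ℕ) :
    List (Gate n (Workspace n N)) :=
  [.degree, .neighbor, .fixed (permUnitary (shufflePerm z)), .degree,
    .fixed (signUnitary fun (v, i, b, _, _, (k, a, e)) =>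
      t < (k : ℕ) ∧ F a i (Nat.ofBits e) v (Nat.ofBits b)),
    .degree, .fixed (permUnitary (shufflePerm z).symm), .neighbor, .degree]

/-- The label with vertex `v`, position `i`, counter `k`, and `0` in the other registers. -/
def cleanLabel (z : Fin n) (k : Fin N) (q : Fin n × Fin n) : BasisLabel n (Workspace n N) :=
  (q.1, q.2, Bits.zero _, Bits.zero _, false, (k, z, Bits.zero _))

/-- The counter of a label. -/
def counter (x : BasisLabel n (Workspace n N)) : Fin N := x.2.2.2.2.2.1

open Classical in
/-- The state with amplitude `φ k q` on the label `cleanLabel z k q`. -/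
noncomputable def cleanState (z : Fin n) (φ : Fin N → Fin n × Fin n → ℂ) :
    QState n (Workspace n N) :=
  WithLp.toLp 2 fun x =>
    if x = cleanLabel z (counter x) (x.1, x.2.1) then φ (counter x) (x.1, x.2.1) else 0

theorem cleanState_cleanLabel (z : Fin n) (φ : Fin N → Fin n × Fin n → ℂ) (k : Fin N)
    (q : Fin n × Fin n) : cleanState z φ (cleanLabel z k q) = φ k q := by
  simp [cleanState, cleanLabel, counter]

theorem cleanLabel_injective (z : Fin n) :
    Function.Injective fun kq : Fin N × (Fin n × Fin n) => cleanLabel z kq.1 kq.2 := by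
  rintro ⟨k, v, i⟩ ⟨k', v', i'⟩ h
  simp only [cleanLabel, Prod.mk.injEq] at h
  obtain ⟨rfl, rfl, _, _, _, rfl, _⟩ := h
  rfl

theorem cleanState_of_forall_ne {z : Fin n} (φ : Fin N → Fin n × Fin n → ℂ)
    {x : BasisLabel n (Workspace n N)} (h : ∀ k q, x ≠ cleanLabel z k q) :
    cleanState z φ x = 0 := by
  simp [cleanState, h]

theorem eq_cleanState {z : Fin n} {ψ : QState n (Workspace n N)}
    {φ : Fin N → Fin n × Fin n → ℂ} (h : ∀ k q, ψ (cleanLabel z k q) = φ k q)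
    (h' : ∀ x, (∀ k q, x ≠ cleanLabel z k q) → ψ x = 0) : ψ = cleanState z φ := by
  ext x
  by_cases hx : ∃ k q, x = cleanLabel z k q
  · obtain ⟨k, q, rfl⟩ := hx; rw [h, cleanState_cleanLabel]
  · push Not at hx
    rw [h' x hx, cleanState_of_forall_ne _ hx]

theorem sum_norm_sq_cleanState (z : Fin n) (φ : Fin N → Fin n × Fin n → ℂ)
    (B : Fin N → Prop) [DecidablePred B]
    [DecidablePred fun x : BasisLabel n (Workspace n N) => B (counter x)] :
    ∑ x with B (counter x), ‖cleanState z φ x‖ ^ 2 = ∑ k with B k, ∑ q, ‖φ k q‖ ^ 2 := by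
  classical
  rw [Finset.sum_sigma']
  symm
  refine Finset.sum_of_injOn (fun kq => cleanLabel z kq.1 kq.2) ?_ ?_ ?_ ?_
  · rintro ⟨k, q⟩ _ ⟨k', q'⟩ _ h
    have := cleanLabel_injective z (a₁ := (k, q)) (a₂ := (k', q')) h
    simp only [Prod.mk.injEq] at this
    obtain ⟨rfl, rfl⟩ := this; rfl
  · rintro ⟨k, q⟩ h
    simp only [Finset.coe_sigma, Set.mem_sigma_iff, Finset.mem_coe, Finset.mem_filter] at h ⊢
    exact ⟨Finset.mem_univ _, h.1.2⟩
  · intro x hx hx'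
    rw [cleanState_of_forall_ne, norm_zero]; · norm_num
    rintro k q rfl
    refine hx' ⟨⟨k, q⟩, ?_, rfl⟩
    have : B k := (Finset.mem_filter.1 hx).2
    simp [this]
  · rintro ⟨k, q⟩ _
    simp only [cleanState_cleanLabel]

theorem norm_sq_cleanState (z : Fin n) (φ : Fin N → Fin n × Fin n → ℂ) :
    ‖cleanState z φ‖ ^ 2 = ∑ k, ∑ q, ‖φ k q‖ ^ 2 := by
  classical
  rw [EuclideanSpace.norm_sq_eq]
  simpa using sum_norm_sq_cleanState z φ (fun _ => True)

variable (G : SimpleGraph (Fin n)) [DecidableRel G.Adj] (L : NeighborOrder G)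

/-- The answer to a neighbor query, where `⊥` is replaced by `z`. -/
def answerVertex (z : Fin n) (q : Fin n × Fin n) : Fin n :=
  if h : neighborAnswer L q.1 q.2 < n then ⟨neighborAnswer L q.1 q.2, h⟩ else z

/-- The marker `F` holds at the vertex `q.1` and the position `q.2`. -/
def Marked (z : Fin n) (F : Marker n) (q : Fin n × Fin n) : Prop :=
  F q.1 q.2 (G.degree q.1) (answerVertex G L z q) (G.degree (answerVertex G L z q))

theorem degree_lt_two_pow_clog (v : Fin n) : G.degree v < 2 ^ Nat.clog 2 n := by
  have h : G.degree v < n := by simpa using G.degree_lt_card_verts v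
  exact h.trans_le (Nat.le_pow_clog one_lt_two n)

theorem neighborAnswer_lt_two_pow_clog (v i : Fin n) :
    neighborAnswer L v i < 2 ^ Nat.clog 2 (n + 1) := by
  have h : neighborAnswer L v i < n + 1 := by
    unfold neighborAnswer; split_ifs <;> omega
  exact h.trans_le (Nat.le_pow_clog one_lt_two _)

theorem permUnitary_degree (ψ : QState n (Workspace n N)) (v i b c p w) :
    permUnitary (degreePerm G _) ψ (v, i, b, c, p, w) =
      ψ (v, i, b.xorNat (G.degree v), c, p, w) := rfl

theorem permUnitary_neighbor (ψ : QState n (Workspace n N)) (v i b c p w) :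
    permUnitary (neighborPerm G L _) ψ (v, i, b, c, p, w) =
      ψ (v, i, b, c.xorNat (neighborAnswer L v i), p, w) := rfl

theorem permUnitary_shuffle (z : Fin n) (ψ : QState n (Workspace n N)) (v i b c p k a e) :
    permUnitary (shufflePerm z) ψ (v, i, b, c, p, (k, a, e)) =
      ψ (a, i, e, c, p, (k, Equiv.swap z (decodeVertex z c) v, b)) := rfl

theorem permUnitary_shuffle_symm (z : Fin n) (ψ : QState n (Workspace n N))
    (v i b c p k a e) :
    permUnitary (shufflePerm z).symm ψ (v, i, b, c, p, (k, a, e)) =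
      ψ (Equiv.swap z (decodeVertex z c) a, i, e, c, p, (k, v, b)) := rfl

-- The gates after the sign change undo those before it, so the circuit is diagonal on all labels
-- (`key`). On a clean label the auxiliary vertex is `z`; the shuffle exchanges `z` with the decoded
-- answer and thereby brings the neighbor into the vertex register, ready for the second degree
-- query. The answer `⊥` decodes to `z`.
open Classical in
theorem runList_phaseCircuit (z : Fin n) (F : Marker n) (t : ℕ)
    (φ : Fin N → Fin n × Fin n → ℂ) :
    Gate.runList G L (phaseCircuit z F t) (cleanState z φ) =
      cleanState z fun k q =>
        if t < (k : ℕ) ∧ Marked G L z F q then -φ k q else φ k q := by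
  have key : ∀ (ψ : QState n (Workspace n N)) v i b c p k a e u,
      u = Equiv.swap z (decodeVertex z (c.xorNat (neighborAnswer L v i))) a →
      Gate.runList G L (phaseCircuit z F t) ψ (v, i, b, c, p, (k, a, e)) =
        if t < (k : ℕ) ∧ F v i (Nat.ofBits (b.xorNat (G.degree v))) u
            (Nat.ofBits (e.xorNat (G.degree u)))
        then -ψ (v, i, b, c, p, (k, a, e)) else ψ (v, i, b, c, p, (k, a, e)) := by
    rintro ψ v i b c p k a e u rfl
    simp only [phaseCircuit, Gate.runList, List.foldl, Gate.apply, permUnitary_degree,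
      permUnitary_neighbor, permUnitary_shuffle, permUnitary_shuffle_symm, signUnitary_apply,
      Bits.xorNat_xorNat, Equiv.swap_apply_self]
    congr
  refine eq_cleanState (fun k q => ?_) fun x hx => ?_
  · have h1 : decodeVertex z ((Bits.zero (Nat.clog 2 (n + 1))).xorNat
        (neighborAnswer L q.1 q.2)) = answerVertex G L z q := by
      simp only [decodeVertex, answerVertex,
        Bits.ofBits_xorNat_zero (neighborAnswer_lt_two_pow_clog G L q.1 q.2)]
    rw [← cleanState_cleanLabel z φ k q, cleanLabel,
      key _ _ _ _ _ _ _ _ _ (answerVertex G L z q) (by rw [h1, Equiv.swap_apply_left])]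
    simp only [Bits.ofBits_xorNat_zero (degree_lt_two_pow_clog G _), Marked]
    congr
  · obtain ⟨v, i, b, c, p, k, a, e⟩ := x
    rw [key _ _ _ _ _ _ _ _ _ _ rfl, cleanState_of_forall_ne _ hx]
    simp

theorem listCost_phaseCircuit (z : Fin n) (F : Marker n) (t : ℕ) :
    Gate.listCost (phaseCircuit (N := N) z F t) = 6 := rfl

end Oracle

/-! ## The Fourier transform of the counter -/

section Fourier

variable (N : ℕ)

/-- The primitive `N`-th root of unity `exp (2 π i / N)`. -/
noncomputable def rootOfUnity : ℂ := Complex.exp (2 * Real.pi * Complex.I / N)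

theorem star_rootOfUnity_mul_self : star (rootOfUnity N) * rootOfUnity N = 1 := by
  rw [rootOfUnity, Complex.star_def, ← Complex.exp_conj, ← Complex.exp_add]
  have h2 : (starRingEnd ℂ) 2 = 2 := Complex.conj_ofNat 2
  simp [neg_div, h2]

/-- The Fourier basis vectors. -/
noncomputable def fourierVector (y : Fin N) : EuclideanSpace ℂ (Fin N) :=
  WithLp.toLp 2 fun k => (rootOfUnity N ^ (y : ℕ)) ^ (k : ℕ) / (Real.sqrt N : ℂ)

/-- Off the diagonal the inner product is a geometric sum whose ratio `r` is an `N`-th root of unity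
other than `1`. -/
theorem orthonormal_fourierVector [NeZero N] : Orthonormal ℂ (fourierVector N) := by
  rw [orthonormal_iff_ite]
  intro y y'
  have hN : (N : ℂ) ≠ 0 := Nat.cast_ne_zero.2 (NeZero.ne N)
  have hs : (Real.sqrt N : ℂ) * (Real.sqrt N : ℂ) = N := by
    rw [← Complex.ofReal_mul, Real.mul_self_sqrt (Nat.cast_nonneg N)]; simp
  set r : ℂ := star (rootOfUnity N ^ (y : ℕ)) * rootOfUnity N ^ (y' : ℕ) with hr
  have hin : inner ℂ (fourierVector N y) (fourierVector N y') =
      (∑ k ∈ Finset.range N, r ^ k) / N := by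
    rw [← Fin.sum_univ_eq_sum_range, Finset.sum_div]
    simp only [fourierVector, PiLp.inner_apply, RCLike.inner_apply, map_div₀, map_pow,
      Complex.conj_ofReal]
    refine Finset.sum_congr rfl fun k _ => ?_
    rw [← hs, hr, mul_pow, star_pow, div_mul_div_comm, mul_comm]
    rfl
  have hunit : ∀ j : ℕ, star (rootOfUnity N ^ j) * rootOfUnity N ^ j = 1 := fun j => by
    rw [star_pow, ← mul_pow, star_rootOfUnity_mul_self, one_pow]
  have hprim : IsPrimitiveRoot (rootOfUnity N) N := Complex.isPrimitiveRoot_exp N (NeZero.ne N)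
  rw [hin]
  split_ifs with h
  · subst h
    rw [hr, hunit]
    simp [hN]
  · have hr1 : r ≠ 1 := by
      intro h1
      apply h
      have h2 : rootOfUnity N ^ (y' : ℕ) = rootOfUnity N ^ (y : ℕ) := by
        calc rootOfUnity N ^ (y' : ℕ)
            = (star (rootOfUnity N ^ (y : ℕ)) * rootOfUnity N ^ (y : ℕ)) *
              rootOfUnity N ^ (y' : ℕ) := by rw [hunit, one_mul]
          _ = r * rootOfUnity N ^ (y : ℕ) := by rw [hr]; ring
          _ = _ := by rw [h1, one_mul]
      exact Fin.ext (hprim.pow_inj y'.2 y.2 h2).symm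
    have hrN : r ^ N = 1 := by
      have hp : ∀ j : ℕ, (rootOfUnity N ^ j) ^ N = 1 := fun j => by
        rw [← pow_mul, mul_comm, pow_mul, hprim.pow_eq_one, one_pow]
      rw [hr, mul_pow, ← star_pow, hp, hp]; simp
    rw [geom_sum_eq hr1, hrN]; simp

/-- The inverse quantum Fourier transform. -/
noncomputable def counterFourier [NeZero N] : EuclideanSpace ℂ (Fin N) ≃ₗᵢ[ℂ] EuclideanSpace ℂ (Fin N) :=
  (OrthonormalBasis.mk (orthonormal_fourierVector N) (by
    rw [(orthonormal_fourierVector N).linearIndependent.span_eq_top_of_card_eq_finrank'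
      (by simp)])).repr

variable {N}

theorem counterFourier_apply [NeZero N] (γ : EuclideanSpace ℂ (Fin N)) (y : Fin N) :
    counterFourier N γ y = ∑ k, γ k * star ((rootOfUnity N ^ (y : ℕ)) ^ (k : ℕ)) / (Real.sqrt N : ℂ) := by
  rw [counterFourier, OrthonormalBasis.repr_apply_apply, OrthonormalBasis.coe_mk, PiLp.inner_apply]
  simp [fourierVector, mul_div_assoc]

/-- A shift becomes a phase under the transform. There is no wraparound to account for, because the
entry that is pushed out is zero. -/
theorem counterFourier_shift [NeZero N] (γ : ℕ → ℂ) (hγ : γ (N - 1) = 0) (y : Fin N) :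
    counterFourier N (WithLp.toLp 2 fun k => if (k : ℕ) = 0 then 0 else γ (k - 1)) y =
      star (rootOfUnity N ^ (y : ℕ)) * counterFourier N (WithLp.toLp 2 fun k => γ k) y := by
  obtain ⟨M, rfl⟩ := Nat.exists_eq_succ_of_ne_zero (NeZero.ne N)
  simp only [counterFourier_apply]
  rw [Fin.sum_univ_succ, Fin.sum_univ_castSucc, mul_add, Finset.mul_sum]
  simp only [Nat.succ_eq_add_one, Nat.add_sub_cancel] at hγ
  simp only [Fin.val_zero, if_true, zero_mul, zero_div, zero_add, Fin.val_succ,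
    Nat.add_sub_cancel, Fin.val_last, hγ, mul_zero, add_zero, Fin.val_castSucc]
  refine Finset.sum_congr rfl fun k _ => ?_
  rw [if_neg (by omega), pow_succ, star_mul]
  ring

theorem norm_one_sub_exp_mul_star (θ : ℝ) (y : ℕ) :
    ‖1 - Complex.exp (2 * θ * Complex.I) * star (rootOfUnity N ^ y)‖ ^ 2 =
      4 * Real.sin (θ - Real.pi * y / N) ^ 2 := by
  have h : Complex.exp (2 * θ * Complex.I) * star (rootOfUnity N ^ y) =
      Complex.exp (Complex.I * (2 * (θ - Real.pi * y / N) : ℝ)) := by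
    rw [rootOfUnity, ← Complex.exp_nat_mul, Complex.star_def, ← Complex.exp_conj,
      ← Complex.exp_add]
    congr 1
    have h2 : (starRingEnd ℂ) 2 = 2 := Complex.conj_ofNat 2
    simp [h2]
    ring
  rw [h, norm_sub_rev, Complex.norm_exp_I_mul_ofReal_sub_one]
  rw [mul_div_cancel_left₀ _ two_ne_zero, Real.norm_eq_abs, sq_abs]
  ring

/-- Parseval for a discrete derivative: `4 sin²` is `|1 - e^{2iθ} ω^{-y}|²`, so it is the effect of
subtracting from the vector its shift multiplied by `e^{2iθ}`. The phases of neighboring entries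
then agree, and only the differences of `a` remain. No single outcome probability has to be
estimated. -/
theorem sum_norm_sq_counterFourier_mul_sin_sq [NeZero N] (a : ℕ → ℝ) (ha0 : a 0 = 0)
    (haN : a (N - 1) = 0) (θ : ℝ) :
    ∑ y : Fin N, ‖counterFourier N (WithLp.toLp 2 fun k : Fin N =>
        (a k : ℂ) * Complex.exp ((2 * (k : ℕ) + 1) * θ * Complex.I)) y‖ ^ 2 *
          Real.sin (θ - Real.pi * y / N) ^ 2 =
      (∑ k ∈ Finset.range N, (a k - a (k - 1)) ^ 2) / 4 := by
  set γ : ℕ → ℂ := fun k => (a k : ℂ) * Complex.exp ((2 * (k : ℕ) + 1) * θ * Complex.I) with hγ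
  set V : EuclideanSpace ℂ (Fin N) := WithLp.toLp 2 fun k : Fin N => γ k with hV
  set V' : EuclideanSpace ℂ (Fin N) :=
    WithLp.toLp 2 fun k : Fin N => if (k : ℕ) = 0 then 0 else γ (k - 1) with hV'
  have h1 : ∀ y, ‖counterFourier N V y‖ ^ 2 * Real.sin (θ - Real.pi * y / N) ^ 2 =
      ‖counterFourier N (V - Complex.exp (2 * θ * Complex.I) • V') y‖ ^ 2 / 4 := by
    intro y
    have h2 : counterFourier N (V - Complex.exp (2 * θ * Complex.I) • V') y =
        counterFourier N V y * (1 - Complex.exp (2 * θ * Complex.I) * star (rootOfUnity N ^ (y : ℕ))) := by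
      rw [map_sub, map_smul, PiLp.sub_apply, PiLp.smul_apply, hV',
        counterFourier_shift γ (by simp [hγ, haN])]
      simp only [smul_eq_mul]
      ring
    rw [h2, norm_mul, mul_pow, norm_one_sub_exp_mul_star]
    ring
  rw [Finset.sum_congr rfl fun y _ => h1 y, ← Finset.sum_div, ← EuclideanSpace.norm_sq_eq,
    LinearIsometryEquiv.norm_map, EuclideanSpace.norm_sq_eq,
    ← Fin.sum_univ_eq_sum_range (fun k => (a k - a (k - 1)) ^ 2)]
  congr 1
  refine Finset.sum_congr rfl fun k _ => ?_
  simp only [hV, hV', PiLp.sub_apply, PiLp.smul_apply, smul_eq_mul]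
  split_ifs with hk
  · simp [hγ, hk, ha0]
  · have h3 : γ k - Complex.exp (2 * θ * Complex.I) * γ (k - 1) =
        ((a k - a (k - 1) : ℝ) : ℂ) *
          Complex.exp (((2 * (k : ℕ) + 1) * θ : ℝ) * Complex.I) := by
      have h4 : Complex.exp (2 * θ * Complex.I) *
          Complex.exp ((2 * ((k : ℕ) - 1 : ℕ) + 1) * θ * Complex.I) =
          Complex.exp (((2 * (k : ℕ) + 1) * θ : ℝ) * Complex.I) := by
        rw [← Complex.exp_add]
        congr 1
        rw [Nat.cast_sub (Nat.one_le_iff_ne_zero.2 hk)]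
        push_cast
        ring
      simp only [hγ]
      rw [mul_left_comm, h4]
      push_cast
      ring
    rw [h3, norm_mul, Complex.norm_exp_ofReal_mul_I, mul_one, Complex.norm_real,
      Real.norm_eq_abs, sq_abs]

end Fourier

/-! ## The window -/

section Window

/-- A triangular function on `{0, …, 2 u}`. -/
def triangle (u k : ℕ) : ℕ := min k (2 * u - k)

theorem triangle_zero (u : ℕ) : triangle u 0 = 0 := by simp [triangle]

theorem triangle_eq_zero {u k : ℕ} (h : 2 * u ≤ k) : triangle u k = 0 := by
  simp [triangle, h]

theorem le_three_mul_sum_triangle {u N : ℕ} (h : u < N) :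
    u ^ 3 ≤ 3 * ∑ k ∈ Finset.range N, triangle u k ^ 2 := by
  have h1 : u ^ 3 ≤ 3 * ∑ k ∈ Finset.range (u + 1), k ^ 2 := by
    clear h
    induction u with
    | zero => simp
    | succ u ih =>
      rw [Finset.sum_range_succ, mul_add]
      calc (u + 1) ^ 3 ≤ u ^ 3 + 3 * (u + 1) ^ 2 := by ring_nf; omega
        _ ≤ _ := by omega
  refine h1.trans (Nat.mul_le_mul_left 3 ?_)
  calc ∑ k ∈ Finset.range (u + 1), k ^ 2 = ∑ k ∈ Finset.range (u + 1), triangle u k ^ 2 := by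
        refine Finset.sum_congr rfl fun k hk => ?_
        have := Finset.mem_range.1 hk
        rw [triangle, min_eq_left (by omega)]
    _ ≤ _ := Finset.sum_le_sum_of_subset (by
        intro k; simp only [Finset.mem_range]; omega)

theorem sum_triangle_sub_sq_le (u N : ℕ) :
    ∑ k ∈ Finset.range N, ((triangle u k : ℝ) - triangle u (k - 1)) ^ 2 ≤ 2 * u := by
  have h1 : ∀ k, ((triangle u k : ℝ) - triangle u (k - 1)) ^ 2 ≤
      if k ∈ Finset.Icc 1 (2 * u) then 1 else 0 := by
    intro k
    have h2 : triangle u k ≤ triangle u (k - 1) + 1 ∧ triangle u (k - 1) ≤ triangle u k + 1 := by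
      simp only [triangle]; omega
    split_ifs with hk
    · rw [sq_le_one_iff_abs_le_one, abs_le]
      have h3 : (triangle u k : ℝ) ≤ triangle u (k - 1) + 1 := by exact_mod_cast h2.1
      have h4 : (triangle u (k - 1) : ℝ) ≤ triangle u k + 1 := by exact_mod_cast h2.2
      constructor <;> linarith
    · have : triangle u k = triangle u (k - 1) := by
        simp only [Finset.mem_Icc, not_and_or] at hk
        simp only [triangle]; omega
      rw [this]; simp
  refine (Finset.sum_le_sum fun k _ => h1 k).trans ?_
  rw [Finset.sum_ite_mem, Finset.sum_const, nsmul_eq_mul, mul_one]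
  have h5 := Finset.card_le_card (Finset.inter_subset_right (s₁ := Finset.range N)
    (s₂ := Finset.Icc 1 (2 * u)))
  rw [Nat.card_Icc] at h5
  calc (((Finset.range N ∩ Finset.Icc 1 (2 * u)).card : ℕ) : ℝ) ≤ ((2 * u + 1 - 1 : ℕ) : ℝ) :=
        Nat.cast_le.2 h5
    _ = _ := by simp

/-- The normalized triangular window. -/
noncomputable def window (N u k : ℕ) : ℝ :=
  triangle u k / Real.sqrt (∑ k ∈ Finset.range N, (triangle u k : ℝ) ^ 2)

theorem sum_triangle_sq_pos {N u : ℕ} (hu : 1 ≤ u) (h : u < N) :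
    (u : ℝ) ^ 3 / 3 ≤ ∑ k ∈ Finset.range N, (triangle u k : ℝ) ^ 2 ∧
    0 < ∑ k ∈ Finset.range N, (triangle u k : ℝ) ^ 2 := by
  have h1 : (u : ℝ) ^ 3 ≤ 3 * ∑ k ∈ Finset.range N, (triangle u k : ℝ) ^ 2 := by
    exact_mod_cast le_three_mul_sum_triangle h
  have h2 : (0 : ℝ) < (u : ℝ) ^ 3 := by positivity
  constructor <;> linarith

theorem sum_window_sq {N u : ℕ} (hu : 1 ≤ u) (h : u < N) :
    ∑ k ∈ Finset.range N, window N u k ^ 2 = 1 := by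
  have h1 := (sum_triangle_sq_pos hu h).2
  simp only [window, div_pow, Real.sq_sqrt h1.le]
  rw [← Finset.sum_div, div_self h1.ne']

/-- The triangle has at most `2 u` steps, each of size at most one, against a squared norm of at
least `u³ / 3`. The jumps at the ends of a flat window would only give order `1 / u`. -/
theorem sum_window_sub_sq_le {N u : ℕ} (hu : 1 ≤ u) (h : u < N) :
    ∑ k ∈ Finset.range N, (window N u k - window N u (k - 1)) ^ 2 ≤ 6 / u ^ 2 := by
  have h1 := sum_triangle_sq_pos hu h
  have hu' : (0 : ℝ) < u := by positivity
  simp only [window, ← sub_div, div_pow, Real.sq_sqrt h1.2.le]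
  rw [← Finset.sum_div, div_le_div_iff₀ h1.2 (by positivity)]
  have := sum_triangle_sub_sq_le u N
  calc _ ≤ 2 * (u : ℝ) * u ^ 2 := by gcongr
    _ = 6 * ((u : ℝ) ^ 3 / 3) := by ring
    _ ≤ _ := by linarith [h1.1]

theorem window_zero (N u : ℕ) : window N u 0 = 0 := by simp [window, triangle_zero]

theorem window_eq_zero {N u k : ℕ} (h : 2 * u ≤ k) : window N u k = 0 := by
  simp [window, triangle_eq_zero h]

end Window

/-! ## Amplitude estimation -/

section Estimation

variable {n N : ℕ}

/-- Separate the counter from the other registers. -/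
def counterEquiv : BasisLabel n (Workspace n N) ≃
    (Fin n × Fin n × Bits (Nat.clog 2 n) × Bits (Nat.clog 2 (n + 1)) × Bool × Fin n ×
      Bits (Nat.clog 2 n)) × Fin N where
  toFun := fun (v, i, b, c, p, (k, a, e)) => ((v, i, b, c, p, a, e), k)
  invFun := fun ((v, i, b, c, p, a, e), k) => (v, i, b, c, p, (k, a, e))
  left_inv _ := rfl
  right_inv _ := rfl

/-- Separate the two query arguments from the other registers. -/
def argumentEquiv : BasisLabel n (Workspace n N) ≃
    (Bits (Nat.clog 2 n) × Bits (Nat.clog 2 (n + 1)) × Bool × Workspace n N) ×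
      (Fin n × Fin n) where
  toFun := fun (v, i, w) => (w, (v, i))
  invFun := fun (w, (v, i)) => (v, i, w)
  left_inv _ := rfl
  right_inv _ := rfl

/-- The inverse quantum Fourier transform of the counter register. -/
noncomputable def fourierUnitary (n N : ℕ) [NeZero N] :
    QState n (Workspace n N) ≃ₗᵢ[ℂ] QState n (Workspace n N) :=
  blockUnitary counterEquiv fun _ => counterFourier N

theorem fourierUnitary_cleanState [NeZero N] (z : Fin n) (φ : Fin N → Fin n × Fin n → ℂ) :
    fourierUnitary n N (cleanState z φ) =
      cleanState z fun y q => counterFourier N (WithLp.toLp 2 fun k => φ k q) y := by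
  refine eq_cleanState (fun k q => ?_) fun x hx => ?_
  · have h : (WithLp.toLp 2 fun j => cleanState z φ
        (counterEquiv.symm ((counterEquiv (cleanLabel z k q)).1, j)) :
        EuclideanSpace ℂ (Fin N)) = WithLp.toLp 2 fun j => φ j q := by
      ext j
      exact cleanState_cleanLabel z φ j q
    rw [fourierUnitary, blockUnitary_apply, h]
    rfl
  · rw [fourierUnitary, blockUnitary_apply]
    have h : (WithLp.toLp 2 fun k => cleanState z φ (counterEquiv.symm ((counterEquiv x).1, k)) :
        EuclideanSpace ℂ (Fin N)) = 0 := by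
      ext k
      refine cleanState_of_forall_ne φ fun k' q h' => ?_
      obtain ⟨v, i, b, c, p, j, a, e⟩ := x
      refine hx j q ?_
      simp only [counterEquiv, cleanLabel, Equiv.coe_fn_mk, Equiv.coe_fn_symm_mk,
        Prod.mk.injEq] at h' ⊢
      tauto
    rw [h, map_zero]; rfl

open Classical in
/-- The (unnormalized) uniform superposition of the elements of `S`. -/
noncomputable def indicatorState (S : Finset (Fin n × Fin n)) :
    EuclideanSpace ℂ (Fin n × Fin n) :=
  WithLp.toLp 2 fun q => if q ∈ S then 1 else 0

open Classical in
/-- The reflection about the uniform superposition of `S`, controlled by the counter. -/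
noncomputable def reflectUnitary (N : ℕ) (S : Finset (Fin n × Fin n)) (t : ℕ) :
    QState n (Workspace n N) ≃ₗᵢ[ℂ] QState n (Workspace n N) :=
  blockUnitary argumentEquiv fun w =>
    if t < (w.2.2.2.1 : ℕ) then (Submodule.span ℂ {indicatorState S}).reflection
    else LinearIsometryEquiv.refl ℂ _

theorem reflection_indicatorState (S : Finset (Fin n × Fin n)) [DecidableEq (Fin n × Fin n)]
    (φ : EuclideanSpace ℂ (Fin n × Fin n)) (q : Fin n × Fin n) :
    (Submodule.span ℂ {indicatorState S}).reflection φ q =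
      (if q ∈ S then 2 * (∑ q' ∈ S, φ q') / S.card else 0) - φ q := by
  have h1 : inner ℂ (indicatorState S) φ = ∑ q' ∈ S, φ q' := by
    rw [PiLp.inner_apply]
    simp [indicatorState]
  have h2 : ((‖indicatorState S‖ : ℝ) : ℂ) ^ 2 = S.card := by
    rw [← Complex.ofReal_pow, EuclideanSpace.norm_sq_eq]
    have : ∀ q, ‖indicatorState S q‖ ^ 2 = if q ∈ S then 1 else 0 := by
      intro q; simp only [indicatorState]; split_ifs <;> simp
    simp [this]
  rw [Submodule.reflection_singleton_apply, h1]
  have h3 : ((‖indicatorState S‖ : ℝ) : ℂ) ^ 2 = (RCLike.ofReal ‖indicatorState S‖ : ℂ) ^ 2 := rfl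
  rw [← h3, h2]
  simp only [PiLp.sub_apply, PiLp.smul_apply, indicatorState, smul_eq_mul]
  split_ifs <;> simp [mul_div_assoc]

open Classical in
theorem reflectUnitary_cleanState (S : Finset (Fin n × Fin n)) (t : ℕ) (z : Fin n)
    (φ : Fin N → Fin n × Fin n → ℂ) :
    reflectUnitary N S t (cleanState z φ) = cleanState z fun k q =>
      if t < (k : ℕ) then (if q ∈ S then 2 * (∑ q' ∈ S, φ k q') / S.card else 0) - φ k q
      else φ k q := by
  refine eq_cleanState (fun k q => ?_) fun x hx => ?_
  · have h : (WithLp.toLp 2 fun q' => cleanState z φ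
        (argumentEquiv.symm ((argumentEquiv (cleanLabel z k q)).1, q')) :
        EuclideanSpace ℂ (Fin n × Fin n)) = WithLp.toLp 2 (φ k) := by
      ext q'
      exact cleanState_cleanLabel z φ k q'
    rw [reflectUnitary, blockUnitary_apply, h]
    have h3 : (argumentEquiv (cleanLabel z k q)).1.2.2.2.1 = k := rfl
    have h4 : (argumentEquiv (cleanLabel z k q)).2 = q := rfl
    rw [h3, h4]
    split_ifs with h1 h2
    · rw [reflection_indicatorState, if_pos h2]
    · rw [reflection_indicatorState, if_neg h2]
    · rfl
  · rw [reflectUnitary, blockUnitary_apply]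
    have h : (WithLp.toLp 2 fun q => cleanState z φ
        (argumentEquiv.symm ((argumentEquiv x).1, q)) :
        EuclideanSpace ℂ (Fin n × Fin n)) = 0 := by
      ext q
      refine cleanState_of_forall_ne φ fun k' q' h' => ?_
      obtain ⟨v, i, w⟩ := x
      refine hx k' (v, i) ?_
      simp only [argumentEquiv, cleanLabel, Equiv.coe_fn_mk, Equiv.coe_fn_symm_mk,
        Prod.mk.injEq] at h' ⊢
      tauto
    rw [h, map_zero]; rfl

open Classical in
/-- A unitary that maps `|init⟩` to the unit vector `ψ`. -/
noncomputable def prepareUnitary {W : Type} [Fintype W] (init : BasisLabel n W)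
    (ψ : QState n W) : QState n W ≃ₗᵢ[ℂ] QState n W :=
  if h : ‖ψ‖ = 1 then (exists_unitary_map_basisState init ψ h).choose
  else LinearIsometryEquiv.refl ℂ _

theorem prepareUnitary_basisState {W : Type} [Fintype W] (init : BasisLabel n W)
    {ψ : QState n W} (h : ‖ψ‖ = 1) : prepareUnitary init ψ (QProg.basisState init) = ψ := by
  rw [prepareUnitary, dif_pos h]
  exact (exists_unitary_map_basisState init ψ h).choose_spec

open Classical in
/-- The initial state of amplitude estimation. -/
noncomputable def windowState (N : ℕ) (z : Fin n) (S : Finset (Fin n × Fin n)) (u : ℕ) :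
    QState n (Workspace n N) :=
  cleanState z fun k q => ((window N u k * if q ∈ S then 1 / Real.sqrt S.card else 0 : ℝ) : ℂ)

/-- The circuit of amplitude estimation. -/
noncomputable def estimationCircuit [NeZero N] (init : BasisLabel n (Workspace n N)) (z : Fin n)
    (S : Finset (Fin n × Fin n)) (F : Marker n) (u : ℕ) : List (Gate n (Workspace n N)) :=
  .fixed (prepareUnitary init (windowState N z S u)) ::
    ((List.range (2 * u)).flatMap (fun t => phaseCircuit z F t ++ [.fixed (reflectUnitary N S t)]) ++
    [.fixed (fourierUnitary n N)])

theorem listCost_estimationCircuit [NeZero N] (init : BasisLabel n (Workspace n N)) (z : Fin n)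
    (S : Finset (Fin n × Fin n)) (F : Marker n) (u : ℕ) :
    Gate.listCost (estimationCircuit init z S F u) = 12 * u := by
  have h : ∀ l : List ℕ, Gate.listCost (l.flatMap
      (fun t => phaseCircuit z F t ++ [.fixed (reflectUnitary N S t)])) = 6 * l.length := by
    intro l
    induction l with
    | nil => rfl
    | cons t l ih =>
      simp only [Gate.listCost, List.flatMap_cons, List.map_append, List.sum_append,
        List.length_cons] at ih ⊢
      rw [ih]
      have := listCost_phaseCircuit (N := N) z F t
      simp only [Gate.listCost] at this
      rw [this]
      simp [Gate.cost]
      ring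
  have h2 := h (List.range (2 * u))
  simp only [Gate.listCost, estimationCircuit, List.map_cons, List.map_append, List.sum_cons,
    List.sum_append] at h2 ⊢
  rw [h2]
  simp [Gate.cost]
  ring

/-! ### The plane of the marked and the unmarked superposition. -/

open Classical in
/-- The unit vector at angle `A` in the plane of the marked and of the unmarked elements of `S`. -/
noncomputable def planeVector (S : Finset (Fin n × Fin n)) (M : Fin n × Fin n → Prop) (A : ℝ)
    (q : Fin n × Fin n) : ℝ :=
  if q ∈ S then
    if M q then Real.sin A / Real.sqrt (S.filter M).card
    else Real.cos A / Real.sqrt (S.filter fun q => ¬ M q).card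
  else 0

open Classical in
/-- The fraction of marked elements. -/
noncomputable def markedFraction (S : Finset (Fin n × Fin n)) (M : Fin n × Fin n → Prop) : ℝ :=
  (S.filter M).card / S.card

/-- The angle whose squared sine is the fraction of marked elements. -/
noncomputable def markedAngle (S : Finset (Fin n × Fin n)) (M : Fin n × Fin n → Prop) : ℝ :=
  Real.arcsin (Real.sqrt (markedFraction S M))

section

variable {S : Finset (Fin n × Fin n)} {M : Fin n × Fin n → Prop}

theorem markedFraction_nonneg : 0 ≤ markedFraction S M := by unfold markedFraction; positivity

theorem markedFraction_le_one : markedFraction S M ≤ 1 := by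
  classical
  exact div_le_one_of_le₀ (Nat.cast_le.2 (Finset.card_filter_le _ _)) (Nat.cast_nonneg _)

theorem sin_markedAngle : Real.sin (markedAngle S M) = Real.sqrt (markedFraction S M) :=
  Real.sin_arcsin (by linarith [Real.sqrt_nonneg (markedFraction S M)])
    (Real.sqrt_le_one.2 markedFraction_le_one)

theorem cos_markedAngle (hS : S.Nonempty) [DecidablePred fun q => ¬ M q] : Real.cos (markedAngle S M) =
    Real.sqrt ((S.filter fun q => ¬ M q).card / S.card) := by
  classical
  rw [markedAngle, Real.cos_arcsin, Real.sq_sqrt markedFraction_nonneg]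
  congr 1
  have hS' : (S.card : ℝ) ≠ 0 := Nat.cast_ne_zero.2 hS.card_pos.ne'
  have h : ((S.filter M).card : ℝ) + (S.filter fun q => ¬ M q).card = S.card := by
    rw [← Finset.card_filter_add_card_filter_not (s := S) M]
    push_cast
    congr!
  rw [markedFraction, ← h]
  rw [← h] at hS'
  field_simp
  ring

open Classical in
theorem planeVector_markedAngle (hS : S.Nonempty) (q : Fin n × Fin n) :
    planeVector S M (markedAngle S M) q = if q ∈ S then 1 / Real.sqrt S.card else 0 := by
  unfold planeVector
  split_ifs with h1 h2
  · have : (0 : ℝ) < (S.filter M).card :=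
      Nat.cast_pos.2 (Finset.card_pos.2 ⟨q, Finset.mem_filter.2 ⟨h1, h2⟩⟩)
    rw [sin_markedAngle, markedFraction, Real.sqrt_div this.le, div_right_comm,
      div_self (Real.sqrt_pos.2 this).ne']
  · have : (0 : ℝ) < (S.filter fun q => ¬ M q).card :=
      Nat.cast_pos.2 (Finset.card_pos.2 ⟨q, Finset.mem_filter.2 ⟨h1, h2⟩⟩)
    rw [cos_markedAngle hS, Real.sqrt_div this.le, div_right_comm,
      div_self (Real.sqrt_pos.2 this).ne']
  · rfl

-- A Grover iteration as two reflections: the sign change sends the angle `A` to `-A`, and the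
-- reflection about the uniform superposition, which has angle `markedAngle S M`, sends `-A` to `A +
-- 2 * markedAngle S M`. If one of the two classes is empty, division by zero makes its terms
-- vanish, and the formula persists.
open Classical in
theorem planeVector_rotate (hS : S.Nonempty) (A : ℝ) (q : Fin n × Fin n) :
    (if q ∈ S then 2 * (∑ q' ∈ S, if M q' then -planeVector S M A q' else planeVector S M A q') /
      S.card else 0) - (if M q then -planeVector S M A q else planeVector S M A q) =
      planeVector S M (A + 2 * markedAngle S M) q := by
  set a : ℝ := Nat.cast (S.filter M).card with ha
  set b : ℝ := Nat.cast (S.filter fun q => ¬ M q).card with hb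
  have ha0 : 0 ≤ a := Nat.cast_nonneg _
  have hb0 : 0 ≤ b := Nat.cast_nonneg _
  have hs0 : (0 : ℝ) < S.card := Nat.cast_pos.2 hS.card_pos
  have hsum : ∑ q' ∈ S, (if M q' then -planeVector S M A q' else planeVector S M A q') =
      -(Real.sin A * Real.sqrt a) + Real.cos A * Real.sqrt b := by
    rw [Finset.sum_ite]
    congr 1
    · rw [Finset.sum_congr rfl (g := fun _ => -(Real.sin A / Real.sqrt a))]
      · rw [Finset.sum_const, nsmul_eq_mul, ← ha]
        nth_rw 1 [← Real.mul_self_sqrt ha0]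
        by_cases h : Real.sqrt a = 0
        · simp [h]
        · field_simp
      · intro q hq
        rw [Finset.mem_filter] at hq
        simp [planeVector, hq.1, hq.2, ha]
    · rw [Finset.sum_congr rfl (g := fun _ => Real.cos A / Real.sqrt b)]
      · rw [Finset.sum_const, nsmul_eq_mul, ← hb]
        nth_rw 1 [← Real.mul_self_sqrt hb0]
        by_cases h : Real.sqrt b = 0
        · simp [h]
        · field_simp
      · intro q hq
        rw [Finset.mem_filter] at hq
        simp [planeVector, hq.1, hq.2, hb]
  have hsin : Real.sin (markedAngle S M) = Real.sqrt a / Real.sqrt S.card := by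
    rw [sin_markedAngle, markedFraction, Real.sqrt_div ha0]
  have hcos : Real.cos (markedAngle S M) = Real.sqrt b / Real.sqrt S.card := by
    rw [cos_markedAngle hS, Real.sqrt_div hb0]
  have hss : Real.sqrt S.card * Real.sqrt S.card = S.card := Real.mul_self_sqrt hs0.le
  have hsn : Real.sqrt S.card ≠ 0 := (Real.sqrt_pos.2 hs0).ne'
  rw [hsum]
  generalize Real.sqrt S.card = c at *
  by_cases hq : q ∈ S
  · by_cases hM : M q
    · have hapos : 0 < a := Nat.cast_pos.2 (Finset.card_pos.2 ⟨q, Finset.mem_filter.2 ⟨hq, hM⟩⟩)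
      have hane : Real.sqrt a ≠ 0 := (Real.sqrt_pos.2 hapos).ne'
      simp only [planeVector, hq, hM, if_true, ← ha]
      rw [Real.sin_add, Real.cos_two_mul', Real.sin_two_mul, Real.cos_sq', hsin, hcos, ← hss]
      field_simp
      ring
    · have hbpos : 0 < b := Nat.cast_pos.2 (Finset.card_pos.2 ⟨q, Finset.mem_filter.2 ⟨hq, hM⟩⟩)
      have hbne : Real.sqrt b ≠ 0 := (Real.sqrt_pos.2 hbpos).ne'
      simp only [planeVector, hq, hM, if_true, if_false, ← hb]
      rw [Real.cos_add, Real.cos_two_mul, Real.sin_two_mul, hsin, hcos, ← hss]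
      field_simp
      ring
  · simp [planeVector, hq]

theorem planeVector_eq (A : ℝ) (q : Fin n × Fin n) : planeVector S M A q =
    Real.sin A * planeVector S M (Real.pi / 2) q + Real.cos A * planeVector S M 0 q := by
  simp only [planeVector, Real.sin_pi_div_two, Real.cos_pi_div_two, Real.sin_zero, Real.cos_zero]
  split_ifs <;> simp [div_eq_mul_inv]

/-- The vectors at the angles `π / 2` and `0` have disjoint supports and norm one, unless their
class is empty and they vanish; hence only an inequality. -/
theorem sum_sq_planeVector_le (x y : ℂ) :
    ∑ q, ‖x * (planeVector S M (Real.pi / 2) q : ℝ) + y * (planeVector S M 0 q : ℝ)‖ ^ 2 ≤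
      ‖x‖ ^ 2 + ‖y‖ ^ 2 := by
  classical
  set a : ℝ := Nat.cast (S.filter M).card with ha
  set b : ℝ := Nat.cast (S.filter fun q => ¬ M q).card with hb
  have key : ∀ q, ‖x * (planeVector S M (Real.pi / 2) q : ℝ) + y * (planeVector S M 0 q : ℝ)‖ ^ 2
      = (if q ∈ S.filter M then ‖x‖ ^ 2 / a else 0) +
        (if q ∈ S.filter (fun q => ¬ M q) then ‖y‖ ^ 2 / b else 0) := by
    intro q
    have ha0 : 0 ≤ a := Nat.cast_nonneg _
    have hb0 : 0 ≤ b := Nat.cast_nonneg _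
    by_cases h1 : q ∈ S
    · by_cases h2 : M q
      · have h3 : planeVector S M (Real.pi / 2) q = 1 / Real.sqrt a := by
          simp [planeVector, h1, h2, ha]
        have h4 : planeVector S M 0 q = 0 := by simp [planeVector, h2]
        rw [h3, h4]
        simp [h1, h2, mul_pow, div_eq_mul_inv, abs_of_nonneg, Real.sq_sqrt ha0]
      · have h3 : planeVector S M 0 q = 1 / Real.sqrt b := by
          simp [planeVector, h1, h2, hb]
        have h4 : planeVector S M (Real.pi / 2) q = 0 := by simp [planeVector, h2]
        rw [h3, h4]
        simp [h1, h2, mul_pow, div_eq_mul_inv, abs_of_nonneg, Real.sq_sqrt hb0]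
    · simp [planeVector, h1]
  rw [Finset.sum_congr rfl fun q _ => key q, Finset.sum_add_distrib, Finset.sum_ite_mem,
    Finset.sum_ite_mem, Finset.univ_inter, Finset.univ_inter, Finset.sum_const, Finset.sum_const,
    nsmul_eq_mul, nsmul_eq_mul, ← ha, ← hb, mul_div_assoc', mul_div_assoc', mul_comm a,
    mul_comm b]
  have h : ∀ c x : ℝ, 0 ≤ x → x * c / c ≤ x := fun c x hx => by
    by_cases hc : c = 0
    · simpa [hc] using hx
    · rw [mul_div_cancel_right₀ _ hc]
  exact add_le_add (h _ _ (sq_nonneg _)) (h _ _ (sq_nonneg _))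

end

/-! ### Controlled Grover iterations and the distribution of the outcome. -/

variable (G : SimpleGraph (Fin n)) [DecidableRel G.Adj] (L : NeighborOrder G)

theorem runList_append {W : Type} [Fintype W] (l l' : List (Gate n W)) (ψ : QState n W) :
    Gate.runList G L (l ++ l') ψ = Gate.runList G L l' (Gate.runList G L l ψ) :=
  List.foldl_append

/-- The state of amplitude estimation after `t` Grover iterations. -/
noncomputable def groverState (N : ℕ) (z : Fin n) (S : Finset (Fin n × Fin n)) (F : Marker n)
    (u t : ℕ) : QState n (Workspace n N) :=
  cleanState z fun k q => ((window N u k * planeVector S (Marked G L z F)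
    ((2 * (min (k : ℕ) t : ℕ) + 1) * markedAngle S (Marked G L z F)) q : ℝ) : ℂ)

/-- Step `t` acts only on the branches with counter above `t`, so that after `t` steps the branch
with counter `k` has made `min k t` iterations. -/
theorem groverState_succ (z : Fin n) {S : Finset (Fin n × Fin n)} (hS : S.Nonempty)
    (F : Marker n) (u t : ℕ) :
    Gate.runList G L (phaseCircuit z F t ++ [.fixed (reflectUnitary N S t)])
      (groverState G L N z S F u t) = groverState G L N z S F u (t + 1) := by
  classical
  rw [runList_append, groverState, runList_phaseCircuit]
  change reflectUnitary N S t _ = _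
  rw [reflectUnitary_cleanState, groverState]
  congr 1
  funext k q
  by_cases h : t < (k : ℕ)
  · have e : ∀ A q', (if Marked G L z F q' then
        -((window N u k * planeVector S (Marked G L z F) A q' : ℝ) : ℂ) else
        ((window N u k * planeVector S (Marked G L z F) A q' : ℝ) : ℂ)) =
        ((window N u k * (if Marked G L z F q' then -planeVector S (Marked G L z F) A q' else
          planeVector S (Marked G L z F) A q') : ℝ) : ℂ) := by
      intro A q'; split_ifs <;> push_cast <;> ring
    have hA : (2 * (t + 1 : ℕ) + 1) * markedAngle S (Marked G L z F) =
        (2 * (t : ℕ) + 1) * markedAngle S (Marked G L z F) +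
          2 * markedAngle S (Marked G L z F) := by push_cast; ring
    simp only [h, true_and, if_true, min_eq_right h.le, min_eq_right (Nat.succ_le_of_lt h), e]
    rw [hA, ← planeVector_rotate hS, ← Complex.ofReal_sum, ← Finset.mul_sum]
    split_ifs <;> push_cast <;> ring
  · have h' : (k : ℕ) ≤ t := not_lt.1 h
    simp only [h, false_and, if_false, min_eq_left h', min_eq_left (h'.trans t.le_succ)]

theorem runList_grover (z : Fin n) {S : Finset (Fin n × Fin n)} (hS : S.Nonempty)
    (F : Marker n) (u T : ℕ) :
    Gate.runList G L ((List.range T).flatMap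
      (fun t => phaseCircuit z F t ++ [.fixed (reflectUnitary N S t)]))
      (groverState G L N z S F u 0) = groverState G L N z S F u T := by
  induction T with
  | zero => rfl
  | succ T ih =>
    rw [List.range_succ, List.flatMap_append, runList_append, ih, List.flatMap_singleton,
      groverState_succ G L z hS]

theorem windowState_eq (z : Fin n) {S : Finset (Fin n × Fin n)} (hS : S.Nonempty)
    (F : Marker n) (u : ℕ) : windowState N z S u = groverState G L N z S F u 0 := by
  simp only [windowState, groverState, Nat.min_zero, Nat.cast_zero, mul_zero, zero_add, one_mul,
    planeVector_markedAngle hS]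

theorem norm_windowState (z : Fin n) {S : Finset (Fin n × Fin n)} (hS : S.Nonempty) {u : ℕ}
    (hu : 1 ≤ u) (huN : u < N) : ‖windowState N z S u‖ = 1 := by
  classical
  have hS0 : (S.card : ℝ) ≠ 0 := Nat.cast_ne_zero.2 hS.card_pos.ne'
  have : ‖windowState N z S u‖ ^ 2 = 1 := by
    rw [windowState, norm_sq_cleanState]
    simp only [Complex.norm_real, Real.norm_eq_abs, sq_abs, mul_pow]
    simp only [ite_pow, ← Finset.mul_sum]
    simp [Real.sq_sqrt, hS0, Fin.sum_univ_eq_sum_range (fun k => window N u k ^ 2),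
      sum_window_sq hu huN]
  exact (pow_eq_one_iff_of_nonneg (norm_nonneg _) two_ne_zero).1 this

/-- The Fourier transform of the windowed phase with angle `θ`. -/
noncomputable def phaseAmplitude (N u : ℕ) [NeZero N] (θ : ℝ) (y : Fin N) : ℂ :=
  counterFourier N (WithLp.toLp 2 fun k : Fin N =>
    (window N u k : ℂ) * Complex.exp ((2 * (k : ℕ) + 1) * θ * Complex.I)) y

theorem sum_phaseAmplitude_le [NeZero N] {u : ℕ} (hu : 1 ≤ u) (huN : 2 * u < N) (θ : ℝ) :
    ∑ y, ‖phaseAmplitude N u θ y‖ ^ 2 * Real.sin (θ - Real.pi * y / N) ^ 2 ≤ 3 / (2 * u ^ 2) := by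
  have h := sum_norm_sq_counterFourier_mul_sin_sq (N := N) (window N u) (window_zero N u)
    (window_eq_zero (by omega)) θ
  have h2 := sum_window_sub_sq_le (N := N) hu (by omega)
  simp only [phaseAmplitude]
  rw [h]
  calc _ ≤ 6 / (u : ℝ) ^ 2 / 4 := by gcongr
    _ = _ := by field_simp; norm_num

/-- The windowed phases at `θ` and `-θ` are `Vc ± i Vs`, where `Vs` and `Vc` carry the marked and
the unmarked part of the rotating vector. The parallelogram law then bounds the outcome distribution
by the average of those of the two phases, without diagonalizing the iteration. -/
theorem runList_estimationCircuit [NeZero N] (init : BasisLabel n (Workspace n N)) (z : Fin n)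
    {S : Finset (Fin n × Fin n)} (hS : S.Nonempty) (F : Marker n) {u : ℕ} (hu : 1 ≤ u)
    (huN : 2 * u < N) :
    ∃ φ : Fin N → Fin n × Fin n → ℂ,
      Gate.runList G L (estimationCircuit init z S F u) (QProg.basisState init) =
        cleanState z φ ∧
      ∀ y, ∑ q, ‖φ y q‖ ^ 2 ≤
        (‖phaseAmplitude N u (markedAngle S (Marked G L z F)) y‖ ^ 2 +
          ‖phaseAmplitude N u (-markedAngle S (Marked G L z F)) y‖ ^ 2) / 2 := by
  set θ := markedAngle S (Marked G L z F) with hθ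
  set M := Marked G L z F with hM
  refine ⟨fun y q => counterFourier N (WithLp.toLp 2 fun k : Fin N =>
    ((window N u k * planeVector S M ((2 * (min (k : ℕ) (2 * u) : ℕ) + 1) * θ) q : ℝ) : ℂ)) y,
    ?_, fun y => ?_⟩
  · have h1 : Gate.runList G L (estimationCircuit init z S F u) (QProg.basisState init) =
        fourierUnitary n N (Gate.runList G L ((List.range (2 * u)).flatMap
          (fun t => phaseCircuit z F t ++ [.fixed (reflectUnitary N S t)]))
          (prepareUnitary init (windowState N z S u) (QProg.basisState init))) := by
      change Gate.runList G L (_ ++ _) _ = _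
      rw [runList_append]
      rfl
    rw [h1, prepareUnitary_basisState init (norm_windowState z hS hu (by omega)),
      windowState_eq G L z hS F, runList_grover G L z hS, groverState, fourierUnitary_cleanState]
  · set Vs : EuclideanSpace ℂ (Fin N) := WithLp.toLp 2 fun k : Fin N =>
      ((window N u k * Real.sin ((2 * (k : ℕ) + 1) * θ) : ℝ) : ℂ) with hVs
    set Vc : EuclideanSpace ℂ (Fin N) := WithLp.toLp 2 fun k : Fin N =>
      ((window N u k * Real.cos ((2 * (k : ℕ) + 1) * θ) : ℝ) : ℂ) with hVc
    have h1 : ∀ q, counterFourier N (WithLp.toLp 2 fun k : Fin N =>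
        ((window N u k * planeVector S M ((2 * (min (k : ℕ) (2 * u) : ℕ) + 1) * θ) q : ℝ) : ℂ)) y
        = counterFourier N Vs y * (planeVector S M (Real.pi / 2) q : ℝ) +
          counterFourier N Vc y * (planeVector S M 0 q : ℝ) := by
      intro q
      have h2 : (WithLp.toLp 2 fun k : Fin N =>
          ((window N u k * planeVector S M ((2 * (min (k : ℕ) (2 * u) : ℕ) + 1) * θ) q : ℝ) : ℂ)
          : EuclideanSpace ℂ (Fin N)) =
          ((planeVector S M (Real.pi / 2) q : ℝ) : ℂ) • Vs +
            ((planeVector S M 0 q : ℝ) : ℂ) • Vc := by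
        ext k
        simp only [hVs, hVc, PiLp.add_apply, PiLp.smul_apply, smul_eq_mul]
        -- Only `2 u` steps are run, but the window vanishes on the larger counters, which would
        -- need more.
        by_cases hk : 2 * u ≤ k
        · simp [window_eq_zero hk]
        · rw [min_eq_left (by omega), planeVector_eq]
          push_cast
          ring
      rw [h2, map_add, map_smul, map_smul, PiLp.add_apply, PiLp.smul_apply, PiLp.smul_apply]
      simp only [smul_eq_mul]
      ring
    have h3 : ∀ s : ℝ, s = 1 ∨ s = -1 → phaseAmplitude N u (s * θ) y =
        counterFourier N Vc y + s * (Complex.I * counterFourier N Vs y) := by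
      intro s hs
      have h4 : (WithLp.toLp 2 fun k : Fin N =>
          (window N u k : ℂ) * Complex.exp ((2 * (k : ℕ) + 1) * (s * θ : ℝ) * Complex.I)
          : EuclideanSpace ℂ (Fin N)) = Vc + (s * Complex.I) • Vs := by
        ext k
        simp only [hVs, hVc, PiLp.add_apply, PiLp.smul_apply, smul_eq_mul]
        have h5 : (2 * ((k : ℕ) : ℂ) + 1) * (s * θ : ℝ) * Complex.I =
            ((s * ((2 * (k : ℕ) + 1) * θ) : ℝ) : ℂ) * Complex.I := by push_cast; ring
        rw [h5, Complex.exp_mul_I, ← Complex.ofReal_cos, ← Complex.ofReal_sin]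
        rcases hs with rfl | rfl
        · rw [one_mul]; push_cast; ring
        · rw [neg_one_mul, Real.cos_neg, Real.sin_neg]; push_cast; ring
      rw [phaseAmplitude, h4, map_add, map_smul, PiLp.add_apply, PiLp.smul_apply, smul_eq_mul,
        mul_assoc]
    have h6 := h3 1 (Or.inl rfl)
    have h7 := h3 (-1) (Or.inr rfl)
    rw [one_mul, Complex.ofReal_one, one_mul] at h6
    rw [neg_one_mul, Complex.ofReal_neg, Complex.ofReal_one, neg_one_mul, ← sub_eq_add_neg] at h7
    simp only [h1]
    refine (sum_sq_planeVector_le _ _).trans (le_of_eq ?_)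
    have h8 := parallelogram_law_with_norm ℝ (counterFourier N Vc y)
      (Complex.I * counterFourier N Vs y)
    rw [norm_mul, Complex.norm_I, one_mul] at h8
    rw [h6, h7]
    linarith

/-- The difference factors as `-sin (θ - α) sin (θ + α)`, and `θ + α = 2θ - (θ - α)` bounds the
second factor by `2 sin θ + κ`. The gain of a factor `sin θ` for small fractions is the quantum
speedup. -/
theorem abs_sin_sq_sub_le {α θ κ : ℝ} (hθ : 0 ≤ Real.sin θ) (h : |Real.sin (θ - α)| ≤ κ) :
    |Real.sin α ^ 2 - Real.sin θ ^ 2| ≤ κ ^ 2 + 2 * κ * Real.sin θ := by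
  have h1 : Real.sin α ^ 2 - Real.sin θ ^ 2 = -(Real.sin (θ - α) * Real.sin (θ + α)) := by
    rw [Real.sin_sub, Real.sin_add]
    linear_combination Real.sin θ ^ 2 * Real.sin_sq_add_cos_sq α -
      Real.sin α ^ 2 * Real.sin_sq_add_cos_sq θ
  have h2 : Real.sin (θ + α) = 2 * Real.sin θ * (Real.cos θ * Real.cos (θ - α)) -
      Real.cos (2 * θ) * Real.sin (θ - α) := by
    rw [show θ + α = 2 * θ - (θ - α) by ring, Real.sin_sub, Real.sin_two_mul]; ring
  have h3 : |Real.sin (θ + α)| ≤ 2 * Real.sin θ + κ := by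
    rw [h2]
    refine (abs_sub _ _).trans (add_le_add ?_ ?_)
    · rw [abs_mul, abs_of_nonneg (by linarith : 0 ≤ 2 * Real.sin θ), abs_mul]
      exact mul_le_of_le_one_right (by linarith)
        (mul_le_one₀ (Real.abs_cos_le_one _) (abs_nonneg _) (Real.abs_cos_le_one _))
    · rw [abs_mul]
      exact (mul_le_of_le_one_left (abs_nonneg _) (Real.abs_cos_le_one _)).trans h
  rw [h1, abs_neg, abs_mul]
  calc _ ≤ κ * (2 * Real.sin θ + κ) :=
        mul_le_mul h h3 (abs_nonneg _) ((abs_nonneg _).trans h)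
    _ = _ := by ring

/-- Chebyshev's inequality: so bad an estimate forces the sine of the phase error to be at least `κ`
in absolute value, for `θ` and, as `sin²` is even, for `-θ`. -/
theorem outcomeProb_estimationCircuit_le [NeZero N] (init : BasisLabel n (Workspace n N))
    (z : Fin n) {S : Finset (Fin n × Fin n)} (hS : S.Nonempty) (F : Marker n) {u : ℕ}
    (hu : 1 ≤ u) (huN : 2 * u < N) {κ : ℝ} (hκ : 0 < κ) :
    QProg.outcomeProb G L init (estimationCircuit init z S F u) (fun x =>
      κ ^ 2 + 2 * κ * Real.sqrt (markedFraction S (Marked G L z F)) <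
        |Real.sin (Real.pi * (counter x : ℕ) / N) ^ 2 - markedFraction S (Marked G L z F)|) ≤
      3 / (2 * u ^ 2 * κ ^ 2) := by
  classical
  obtain ⟨φ, hφ, hφ2⟩ := runList_estimationCircuit G L init z hS F hu huN
  set θ := markedAngle S (Marked G L z F) with hθ
  set p := markedFraction S (Marked G L z F) with hp
  have hsin : Real.sin θ = Real.sqrt p := sin_markedAngle
  have hsin2 : Real.sin θ ^ 2 = p := by rw [hsin, Real.sq_sqrt markedFraction_nonneg]
  set B : Fin N → Prop := fun y => κ ^ 2 + 2 * κ * Real.sqrt p <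
    |Real.sin (Real.pi * (y : ℕ) / N) ^ 2 - p| with hB
  have hbad : ∀ s : ℝ, s = 1 ∨ s = -1 → ∀ y : Fin N, B y →
      κ ^ 2 ≤ Real.sin (s * θ - Real.pi * (y : ℕ) / N) ^ 2 := by
    intro s hs y hy
    by_contra hlt
    rw [not_le, sq_lt_sq, abs_of_pos hκ] at hlt
    apply hy.not_ge
    rw [← hsin, ← hsin2]
    rcases hs with rfl | rfl
    · rw [one_mul] at hlt
      exact abs_sin_sq_sub_le (by rw [hsin]; positivity) hlt.le
    · have e : -1 * θ - Real.pi * (y : ℕ) / N = -(θ - -(Real.pi * (y : ℕ) / N)) := by ring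
      rw [e, Real.sin_neg, abs_neg] at hlt
      have := abs_sin_sq_sub_le (by rw [hsin]; positivity) hlt.le
      rwa [Real.sin_neg, neg_sq] at this
  have hmoment : ∀ s : ℝ, s = 1 ∨ s = -1 →
      ∑ y with B y, ‖phaseAmplitude N u (s * θ) y‖ ^ 2 ≤ 3 / (2 * u ^ 2 * κ ^ 2) := by
    intro s hs
    have h1 := sum_phaseAmplitude_le hu huN (s * θ)
    have h2 : (∑ y with B y, ‖phaseAmplitude N u (s * θ) y‖ ^ 2) * κ ^ 2 ≤ 3 / (2 * u ^ 2) := by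
      rw [Finset.sum_mul]
      refine (Finset.sum_le_sum fun y hy => mul_le_mul_of_nonneg_left
        (hbad s hs y (Finset.mem_filter.1 hy).2) (sq_nonneg _)).trans (le_trans ?_ h1)
      exact Finset.sum_le_sum_of_subset_of_nonneg (Finset.filter_subset _ _)
        fun _ _ _ => by positivity
    rw [← div_div, le_div_iff₀ (by positivity)]
    exact h2
  have h1 := hmoment 1 (Or.inl rfl)
  have h2 := hmoment (-1) (Or.inr rfl)
  rw [one_mul] at h1
  rw [neg_one_mul] at h2
  calc QProg.outcomeProb G L init (estimationCircuit init z S F u) (fun x => B (counter x))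
      = ∑ y with B y, ∑ q, ‖φ y q‖ ^ 2 := by
        rw [QProg.outcomeProb, hφ, ← sum_norm_sq_cleanState z φ B]
    _ ≤ ∑ y with B y, (‖phaseAmplitude N u θ y‖ ^ 2 + ‖phaseAmplitude N u (-θ) y‖ ^ 2) / 2 :=
        Finset.sum_le_sum fun y _ => hφ2 y
    _ ≤ _ := by
        rw [← Finset.sum_div, Finset.sum_add_distrib]
        linarith

end Estimation

/-! ## Counting edges -/

section Graph

variable {n : ℕ} (G : SimpleGraph (Fin n)) [DecidableRel G.Adj]

/-- The vertices ordered by their degrees, with ties broken by their numbers. -/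
def DegreeLT (v u : Fin n) : Prop := G.degree v < G.degree u ∨ G.degree v = G.degree u ∧ v < u

open Classical in
/-- The edges, directed towards the endpoint of larger degree, whose lower endpoint has a degree
that satisfies `P`. -/
noncomputable def orderedEdges (P : ℕ → Prop) : Finset (Fin n × Fin n) :=
  Finset.univ.filter fun e => G.Adj e.1 e.2 ∧ DegreeLT G e.1 e.2 ∧ P (G.degree e.1)

open Classical in
theorem mem_orderedEdges {P : ℕ → Prop} {v u : Fin n} : (v, u) ∈ orderedEdges G P ↔
    G.Adj v u ∧ (G.degree v < G.degree u ∨ G.degree v = G.degree u ∧ v < u) ∧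
      P (G.degree v) := by
  rw [orderedEdges, Finset.mem_filter]
  simp [DegreeLT]

open Classical in
theorem sum_degree_eq_card (H : Finset (Fin n)) : ∑ v ∈ H, G.degree v =
    (Finset.univ.filter fun e : Fin n × Fin n => G.Adj e.1 e.2 ∧ e.1 ∈ H).card := by
  rw [Finset.card_eq_sum_card_fiberwise (f := Prod.fst) (t := H)]
  · refine Finset.sum_congr rfl fun v hv => ?_
    rw [← G.card_neighborFinset_eq_degree]
    refine Finset.card_bij (fun u _ => (v, u)) ?_ ?_ ?_
    · intro u hu; simpa [hv] using hu
    · intro u _ u' _ h; simpa using h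
    · rintro ⟨v', u⟩ h
      simp only [Finset.mem_filter, Finset.mem_univ, true_and] at h
      obtain ⟨⟨h1, h2⟩, rfl⟩ := h
      exact ⟨u, by simpa using h1, rfl⟩
  · intro e he
    simp only [Finset.coe_filter, Set.mem_ofPred_eq] at he
    exact he.2.2

/-- The order by degree and number is total, so the directed edges and their reversals partition the
`2 m` ordered adjacent pairs. -/
theorem card_orderedEdges_true : (orderedEdges G fun _ => True).card = G.edgeFinset.card := by
  classical
  have h1 := sum_degree_eq_card G Finset.univ
  rw [G.sum_degrees_eq_twice_card_edges] at h1
  have h2 : (Finset.univ.filter fun e : Fin n × Fin n => G.Adj e.1 e.2 ∧ e.1 ∈ Finset.univ) =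
      (orderedEdges G fun _ => True) ∪ (orderedEdges G fun _ => True).map
        (Equiv.prodComm (Fin n) (Fin n)).toEmbedding := by
    ext ⟨v, u⟩
    simp only [mem_orderedEdges, Finset.mem_filter, Finset.mem_univ, true_and, and_true,
      Finset.mem_union, Finset.mem_map_equiv, Equiv.prodComm_symm, Equiv.prodComm_apply,
      Prod.swap_prod_mk, G.adj_comm u v]
    constructor
    · intro h
      have hne : v ≠ u := G.ne_of_adj h
      rcases lt_trichotomy (G.degree v) (G.degree u) with h3 | h3 | h3
      · exact Or.inl ⟨h, Or.inl h3⟩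
      · rcases lt_or_gt_of_ne hne with h4 | h4
        · exact Or.inl ⟨h, Or.inr ⟨h3, h4⟩⟩
        · exact Or.inr ⟨h, Or.inr ⟨h3.symm, h4⟩⟩
      · exact Or.inr ⟨h, Or.inl h3⟩
    · rintro (h | h) <;> exact h.1
  have h3 : Disjoint (orderedEdges G fun _ => True) ((orderedEdges G fun _ => True).map
        (Equiv.prodComm (Fin n) (Fin n)).toEmbedding) := by
    rw [Finset.disjoint_left]
    rintro ⟨v, u⟩
    simp only [mem_orderedEdges, and_true, Finset.mem_map_equiv, Equiv.prodComm_symm,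
      Equiv.prodComm_apply,
      Prod.swap_prod_mk]
    rintro ⟨_, h⟩ ⟨_, h'⟩
    omega
  rw [h2, Finset.card_union_of_disjoint h3, Finset.card_map] at h1
  omega

theorem card_orderedEdges_add_not (P : ℕ → Prop) :
    (orderedEdges G P).card + (orderedEdges G fun d => ¬ P d).card = G.edgeFinset.card := by
  classical
  rw [← card_orderedEdges_true, ← Finset.card_filter_add_card_filter_not
    (s := orderedEdges G fun _ => True) (fun e => P (G.degree e.1))]
  simp only [orderedEdges, Finset.filter_filter, and_true, and_assoc]

theorem card_orderedEdges_le (P : ℕ → Prop) : (orderedEdges G P).card ≤ G.edgeFinset.card := by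
  have := card_orderedEdges_add_not G P; omega

theorem card_orderedEdges_lt_add (a b : ℕ) (hab : a ≤ b) :
    (orderedEdges G fun d => d < a).card + (orderedEdges G fun d => a ≤ d ∧ d < b).card =
      (orderedEdges G fun d => d < b).card := by
  classical
  rw [← Finset.card_filter_add_card_filter_not
    (s := orderedEdges G fun d => d < b) (fun e => G.degree e.1 < a)]
  simp only [orderedEdges, Finset.filter_filter, and_assoc, not_lt]
  congr 3
  · ext e
    exact ⟨fun ⟨h1, h2, h3⟩ => ⟨h1, h2, h3.trans_le hab, h3⟩, fun ⟨h1, h2, _, h3⟩ => ⟨h1, h2, h3⟩⟩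
  · ext e
    rw [and_comm (a := a ≤ G.degree e.1)]

/-- There are few edges between vertices of large degree. -/
theorem sq_mul_card_orderedEdges_le (P : ℕ → Prop) (K : ℕ) (hP : ∀ d, P d → K ≤ d) :
    K ^ 2 * (orderedEdges G P).card ≤ 4 * G.edgeFinset.card ^ 2 := by
  classical
  set H : Finset (Fin n) := Finset.univ.filter fun v => K ≤ G.degree v with hH
  have h1 : K * H.card ≤ 2 * G.edgeFinset.card := by
    rw [← G.sum_degrees_eq_twice_card_edges, mul_comm, ← smul_eq_mul, ← Finset.sum_const]
    refine (Finset.sum_le_sum fun v hv => (Finset.mem_filter.1 hv).2).trans ?_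
    exact Finset.sum_le_sum_of_subset (Finset.filter_subset _ _)
  -- The upper endpoint has at least the degree of the lower one, so both lie in `H`.
  have h2 : (orderedEdges G P).card ≤ H.card ^ 2 := by
    rw [sq, ← Finset.card_product]
    refine Finset.card_le_card ?_
    rintro ⟨v, u⟩ h
    rw [mem_orderedEdges] at h
    have := hP _ h.2.2
    simp only [hH, Finset.mem_product, Finset.mem_filter, Finset.mem_univ, true_and]
    omega
  calc K ^ 2 * (orderedEdges G P).card ≤ K ^ 2 * H.card ^ 2 := Nat.mul_le_mul_left _ h2
    _ = (K * H.card) ^ 2 := by ring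
    _ ≤ (2 * G.edgeFinset.card) ^ 2 := Nat.pow_le_pow_left h1 2
    _ = _ := by ring

/-- The sum of the degrees, truncated at `D`. -/
def truncatedDegreeSum (D : ℕ) : ℕ := ∑ v, min (G.degree v) D

theorem truncatedDegreeSum_le (D : ℕ) : truncatedDegreeSum G D ≤ 2 * G.edgeFinset.card := by
  rw [← G.sum_degrees_eq_twice_card_edges]
  exact Finset.sum_le_sum fun v _ => min_le_left _ _

/-- An edge leaving a vertex of `H`, the vertices of degree above `D`, either stays in `H` or,
reversed, is counted at a vertex outside; so the degrees in `H` sum to at most `|H|²` plus the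
degrees outside. If `|H| ≤ 2 D`, truncation loses at most half of the degree sum; otherwise the
vertices of `H` alone contribute `|H| D ≥ 2 D²`. -/
theorem le_truncatedDegreeSum (D : ℕ) :
    G.edgeFinset.card ≤ truncatedDegreeSum G D ∨ 2 * D ^ 2 ≤ truncatedDegreeSum G D := by
  classical
  set H : Finset (Fin n) := Finset.univ.filter fun v => D < G.degree v with hH
  set H' : Finset (Fin n) := Finset.univ.filter fun v => ¬ D < G.degree v with hH'
  have h1 : truncatedDegreeSum G D = H.card * D + ∑ v ∈ H', G.degree v := by
    rw [truncatedDegreeSum, ← Finset.sum_filter_add_sum_filter_not _ fun v => D < G.degree v,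
      ← smul_eq_mul, ← Finset.sum_const]
    congr 1
    · exact Finset.sum_congr rfl fun v hv => min_eq_right (Finset.mem_filter.1 hv).2.le
    · exact Finset.sum_congr rfl fun v hv => min_eq_left (not_lt.1 (Finset.mem_filter.1 hv).2)
  have h2 : ∑ v ∈ H, G.degree v ≤ H.card ^ 2 + ∑ v ∈ H', G.degree v := by
    rw [sum_degree_eq_card, sum_degree_eq_card, sq, ← Finset.card_product,
      ← Finset.card_map (Equiv.prodComm (Fin n) (Fin n)).toEmbedding (s := Finset.filter _ _)]
    refine le_trans (Finset.card_le_card ?_) (Finset.card_union_le _ _)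
    rintro ⟨v, u⟩ h
    simp only [Finset.mem_filter, Finset.mem_univ, true_and, Finset.mem_union,
      Finset.mem_product, Finset.mem_map_equiv, Equiv.prodComm_symm, Equiv.prodComm_apply,
      Prod.swap_prod_mk, hH, hH', G.adj_comm u v, not_lt] at h ⊢
    by_cases hv : D < G.degree v
    · exact Or.inl ⟨hv, h.2⟩
    · exact Or.inr ⟨h.1, not_lt.1 hv⟩
  have h3 : ∑ v ∈ H, G.degree v + ∑ v ∈ H', G.degree v = 2 * G.edgeFinset.card := by
    rw [← G.sum_degrees_eq_twice_card_edges]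
    exact Finset.sum_filter_add_sum_filter_not _ _ _
  rcases le_or_gt H.card (2 * D) with h | h
  · left
    have : H.card ^ 2 ≤ 2 * (H.card * D) := by
      rw [sq]; calc H.card * H.card ≤ H.card * (2 * D) := Nat.mul_le_mul_left _ h
        _ = _ := by ring
    omega
  · right
    have : 2 * D ^ 2 ≤ H.card * D := by
      calc 2 * D ^ 2 = 2 * D * D := by ring
        _ ≤ _ := Nat.mul_le_mul_right _ h.le
    omega

/-! ### Markers -/

/-- The pairs of a vertex and a position less than `D`. -/
def positions (n D : ℕ) : Finset (Fin n × Fin n) := Finset.univ.filter fun q => (q.2 : ℕ) < D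

theorem card_positions_le (n D : ℕ) : (positions n D).card ≤ n * D := by
  have h : positions n D = Finset.univ ×ˢ (Finset.univ.filter fun i : Fin n => (i : ℕ) < D) := by
    ext q; simp [positions]
  rw [h, Finset.card_product, Finset.card_univ, Fintype.card_fin]
  refine Nat.mul_le_mul_left _ ?_
  rw [Fin.card_filter_val_lt]
  exact min_le_right _ _

theorem positions_nonempty (z : Fin n) {D : ℕ} (hD : 1 ≤ D) : (positions n D).Nonempty :=
  ⟨(z, ⟨0, z.pos⟩), by simp [positions]; omega⟩

/-- Marks the positions of the neighbors. -/
def degreeMarker (n : ℕ) : Marker n := fun _ i d _ _ => (i : ℕ) < d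

/-- Marks the positions of the neighbors of larger degree, for the vertices whose degree
satisfies `P`. -/
def edgeMarker (n : ℕ) (P : ℕ → Prop) : Marker n := fun v i d u d' =>
  (i : ℕ) < d ∧ (d < d' ∨ d = d' ∧ v < u) ∧ P d

variable (L : NeighborOrder G)

open Classical in
theorem card_filter_degreeMarker (z : Fin n) (D : ℕ) :
    ((positions n D).filter (Marked G L z (degreeMarker n))).card = truncatedDegreeSum G D := by
  rw [Finset.card_eq_sum_card_fiberwise (f := Prod.fst) (t := Finset.univ) (by simp)]
  refine Finset.sum_congr rfl fun v _ => ?_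
  have hv : G.degree v < n := by simpa using G.degree_lt_card_verts v
  have : min (G.degree v) D = (Finset.univ.filter
      fun i : Fin n => (i : ℕ) < min (G.degree v) D).card := by
    rw [Fin.card_filter_val_lt]; omega
  rw [this]
  symm
  refine Finset.card_bij (fun i _ => (v, i)) ?_ ?_ ?_
  · intro i hi
    simpa [positions, Marked, degreeMarker, and_comm] using hi
  · intro i _ i' _ h; simpa using h
  · rintro ⟨v', i⟩ h
    simp only [positions, Marked, degreeMarker, Finset.mem_filter, Finset.mem_univ,
      true_and] at h
    obtain ⟨⟨h1, h2⟩, rfl⟩ := h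
    exact ⟨i, by simp [h1, h2], rfl⟩

theorem answerVertex_of_lt (z v i : Fin n) (h : (i : ℕ) < G.degree v) :
    answerVertex G L z (v, i) = (L v ⟨i, h⟩ : Fin n) := by
  have h1 : neighborAnswer L v i = ((L v ⟨i, h⟩ : Fin n) : ℕ) := dif_pos h
  have h2 : neighborAnswer L v i < n := by rw [h1]; exact Fin.is_lt _
  unfold answerVertex
  rw [dif_pos h2]
  exact Fin.ext h1

-- Each directed edge sits at exactly one position in the list of its lower endpoint, and `hP` keeps
-- that whole list within the first `D` positions.
open Classical in
theorem card_filter_edgeMarker (z : Fin n) (D : ℕ) (P : ℕ → Prop) (hP : ∀ d, P d → d ≤ D) :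
    ((positions n D).filter (Marked G L z (edgeMarker n P))).card = (orderedEdges G P).card := by
  refine Finset.card_bij (fun q _ => (q.1, answerVertex G L z q)) ?_ ?_ ?_
  · rintro ⟨v, i⟩ h
    simp only [Marked, edgeMarker, Finset.mem_filter] at h
    have h2 := h.2.2
    rw [answerVertex_of_lt G L z v i h.2.1] at h2 ⊢
    rw [mem_orderedEdges]
    exact ⟨(L v _).2, h2⟩
  · rintro ⟨v, i⟩ h ⟨v', i'⟩ h' heq
    simp only [Marked, edgeMarker, Finset.mem_filter] at h h'
    rw [answerVertex_of_lt G L z v i h.2.1, answerVertex_of_lt G L z v' i' h'.2.1] at heq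
    simp only [Prod.mk.injEq] at heq
    obtain ⟨rfl, h2⟩ := heq
    have := (L v).injective (Subtype.ext h2)
    simp only [Fin.mk.injEq] at this
    exact Prod.ext rfl (Fin.ext this)
  · rintro ⟨v, u⟩ h
    rw [mem_orderedEdges] at h
    obtain ⟨h1, h2, h3⟩ := h
    obtain ⟨j, hj⟩ := (L v).surjective ⟨u, h1⟩
    have hv : G.degree v < n := by simpa using G.degree_lt_card_verts v
    have hu : answerVertex G L z (v, ⟨j, j.2.trans hv⟩) = u := by
      rw [answerVertex_of_lt G L z v _ j.2]
      change ((L v j : G.neighborSet v) : Fin n) = u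
      rw [hj]
    refine ⟨(v, ⟨j, j.2.trans hv⟩), ?_, by rw [hu]⟩
    simp only [positions, Marked, edgeMarker, Finset.mem_filter, Finset.mem_univ, true_and]
    exact ⟨j.2.trans_le (hP _ h3), j.2, by rw [hu]; exact h2, h3⟩

end Graph

/-! ## Estimating the number of marked positions -/

section Estimate

variable {n N : ℕ} [NeZero N]

/-- Estimate the number of marked elements of `S`, and continue with the estimate. -/
noncomputable def estimate (init : BasisLabel n (Workspace n N)) (z : Fin n)
    (S : Finset (Fin n × Fin n)) (F : Marker n) (u : ℕ)
    (next : ℝ → QProg n (Workspace n N)) : QProg n (Workspace n N) :=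
  QProg.sampleThen init (estimationCircuit init z S F u) fun x =>
    next (S.card * Real.sin (Real.pi * (counter x : ℕ) / N) ^ 2)

variable {G : SimpleGraph (Fin n)} [DecidableRel G.Adj] {L : NeighborOrder G}

open Classical in
theorem abs_estimate_sub_le {S : Finset (Fin n × Fin n)} (hS : S.Nonempty)
    {M : Fin n × Fin n → Prop} {κ s : ℝ}
    (h : ¬ κ ^ 2 + 2 * κ * Real.sqrt (markedFraction S M) < |s - markedFraction S M|) :
    |S.card * s - (S.filter M).card| ≤
      S.card * κ ^ 2 + 2 * κ * Real.sqrt (S.card * (S.filter M).card) := by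
  have hS0 : (0 : ℝ) < S.card := Nat.cast_pos.2 hS.card_pos
  have hc : ((S.filter M).card : ℝ) = S.card * markedFraction S M := by
    rw [markedFraction]; field_simp
  have h1 : Real.sqrt (S.card * (S.filter M).card) = S.card * Real.sqrt (markedFraction S M) := by
    rw [hc, ← mul_assoc, Real.sqrt_mul (by positivity), Real.sqrt_mul_self hS0.le]
  rw [h1, hc, ← mul_sub, abs_mul, abs_of_pos hS0]
  calc _ ≤ (S.card : ℝ) * (κ ^ 2 + 2 * κ * Real.sqrt (markedFraction S M)) := by
        gcongr; exact not_lt.1 h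
    _ = _ := by ring

theorem pairFree_estimate {init : BasisLabel n (Workspace n N)} {z : Fin n}
    {S : Finset (Fin n × Fin n)} {F : Marker n} {u : ℕ} {next : ℝ → QProg n (Workspace n N)}
    (h : ∀ r, (next r).PairFree) : (estimate init z S F u next).PairFree :=
  QProg.pairFree_sampleThen fun _ => h _

variable {init : BasisLabel n (Workspace n N)} {z : Fin n} {S : Finset (Fin n × Fin n)}
  {F : Marker n} {u : ℕ} {next : ℝ → QProg n (Workspace n N)} {κ δ : ℝ}

open Classical in
theorem success_estimate {R : Set ℝ} (hS : S.Nonempty) (hu : 1 ≤ u) (huN : 2 * u < N)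
    (hκ : 0 < κ) (hδ : 3 / (2 * u ^ 2 * κ ^ 2) ≤ δ) {w : ℝ} (hw : 0 ≤ w)
    (h : ∀ e : ℝ, |e - (S.filter (Marked G L z F)).card| ≤ S.card * κ ^ 2 +
        2 * κ * Real.sqrt (S.card * (S.filter (Marked G L z F)).card) →
      1 - w ≤ QProg.success G L init R (next e)) :
    1 - δ - w ≤ QProg.success G L init R (estimate init z S F u next) :=
  QProg.success_sampleThen _ hw
    ((outcomeProb_estimationCircuit_le G L init z hS F hu huN hκ).trans hδ)
    fun _ hx => h _ (abs_estimate_sub_le hS hx)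

open Classical in
theorem queries_estimate (hS : S.Nonempty) (hu : 1 ≤ u) (huN : 2 * u < N)
    (hκ : 0 < κ) (hδ : 3 / (2 * u ^ 2 * κ ^ 2) ≤ δ) {c₀ c₁ : ℝ} (hc₁ : 0 ≤ c₁)
    (h : ∀ e : ℝ, |e - (S.filter (Marked G L z F)).card| ≤ S.card * κ ^ 2 +
        2 * κ * Real.sqrt (S.card * (S.filter (Marked G L z F)).card) →
      QProg.queries G L init (next e) ≤ c₀)
    (h' : ∀ e : ℝ, QProg.queries G L init (next e) ≤ c₀ + c₁) :
    QProg.queries G L init (estimate init z S F u next) ≤ 12 * u + c₀ + δ * c₁ := by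
  have := QProg.queries_sampleThen (G := G) (L := L) _ hc₁
    ((outcomeProb_estimationCircuit_le G L init z hS F hu huN hκ).trans hδ)
    (next := fun x => next (S.card * Real.sin (Real.pi * (counter x : ℕ) / N) ^ 2)) (c₀ := c₀)
    (fun _ hx => h _ (abs_estimate_sub_le hS hx)) (fun _ _ => h' _)
  rw [listCost_estimationCircuit] at this
  simpa [estimate] using this

/-- The deterministic bound on the number of queries. -/
theorem queries_estimate_le {c : ℝ} (h : ∀ e : ℝ, QProg.queries G L init (next e) ≤ c) :
    QProg.queries G L init (estimate init z S F u next) ≤ 12 * u + c := by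
  have := QProg.queries_sampleThen (G := G) (L := L) (init := init)
    (gs := estimationCircuit init z S F u) (fun _ => False) (δ := 0) le_rfl
    (by simp [QProg.outcomeProb])
    (next := fun x => next (S.card * Real.sin (Real.pi * (counter x : ℕ) / N) ^ 2)) (c₀ := c)
    (c₁ := 0) (fun _ _ => h _) (fun _ h => h.elim)
  rw [listCost_estimationCircuit] at this
  simpa [estimate] using this

end Estimate

/-! ## The algorithm -/

section Algorithm

variable {n N : ℕ} [NeZero N]

/-- The ranges of degrees `[0, D)`, `[D, 2 D)`, `[2 D, 4 D)`, … -/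
def levelRange (D : ℕ) : ℕ → ℕ → Prop
  | 0, d => d < D
  | j + 1, d => 2 ^ j * D ≤ d ∧ d < 2 ^ (j + 1) * D

/-- Add to `acc` estimates of the numbers of edges whose lower endpoint has a degree in one of the
first `j` ranges. -/
noncomputable def levels (init : BasisLabel n (Workspace n N)) (z : Fin n) (D u : ℕ) :
    ℕ → ℝ → QProg n (Workspace n N)
  | 0, acc => .output acc
  | j + 1, acc => estimate init z (positions n (2 ^ j * D)) (edgeMarker n (levelRange D j)) u
      fun e => levels init z D u j (acc + e)

/-- The truncation of the degrees in round `r`. -/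
def roundDegree (n r : ℕ) : ℕ := n / 4 ^ r + 1

/-- The size of the windows that decide whether round `r` is the last one. -/
def testWindow (r : ℕ) : ℕ := 60 * 2 ^ r * (r + 2)

/-- The size of the windows that estimate the number of edges in round `r`. -/
def levelWindow (J E r : ℕ) : ℕ := 1200 * 2 ^ r * J ^ 2 * E

open Classical in
/-- Decrease the guess `n ^ 2 / 16 ^ r` for the number of edges until it is small enough; then
estimate the number of edges. -/
noncomputable def rounds (init : BasisLabel n (Workspace n N)) (z : Fin n) (J E : ℕ) :
    ℕ → ℕ → QProg n (Workspace n N)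
  | 0, _ => .output 0
  | fuel + 1, r => estimate init z (positions n (roundDegree n r)) (degreeMarker n)
      (testWindow r) fun e =>
        if ((n : ℝ) / 4 ^ r) ^ 2 / 2 ≤ e then
          levels init z (roundDegree n r) (levelWindow J E r) J 0
        else rounds init z J E fuel (r + 1)

theorem pairFree_levels (init : BasisLabel n (Workspace n N)) (z : Fin n) (D u j : ℕ) (acc : ℝ) :
    (levels init z D u j acc).PairFree := by
  induction j generalizing acc with
  | zero => trivial
  | succ j ih => exact pairFree_estimate fun _ => ih _

theorem pairFree_rounds (init : BasisLabel n (Workspace n N)) (z : Fin n) (J E fuel r : ℕ) :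
    (rounds init z J E fuel r).PairFree := by
  induction fuel generalizing r with
  | zero => trivial
  | succ j ih =>
    refine pairFree_estimate fun _ => ?_
    split_ifs
    · exact pairFree_levels _ _ _ _ _ _
    · exact ih _

variable (G : SimpleGraph (Fin n)) [DecidableRel G.Adj] (L : NeighborOrder G)

theorem levelRange_le {D j d : ℕ} (h : levelRange D j d) : d ≤ 2 ^ j * D := by
  cases j with
  | zero => exact (by simpa [levelRange] using h : d < D).le.trans (by simp)
  | succ j => exact h.2.le

omit [NeZero N] in
theorem sum_card_levelRange (D j : ℕ) :
    ∑ i ∈ Finset.range (j + 1), (orderedEdges G (levelRange D i)).card =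
      (orderedEdges G fun d => d < 2 ^ j * D).card := by
  induction j with
  | zero => simp; rfl
  | succ j ih =>
    rw [Finset.sum_range_succ, ih]
    exact card_orderedEdges_lt_add G _ _ (Nat.mul_le_mul_right _ (by rw [pow_succ]; omega))

variable {init : BasisLabel n (Workspace n N)} {z : Fin n}

theorem queries_levels_le (D u j : ℕ) (acc : ℝ) :
    QProg.queries G L init (levels init z D u j acc) ≤ j * (12 * u) := by
  induction j generalizing acc with
  | zero => simp [levels, QProg.queries_output]
  | succ j ih =>
    refine (queries_estimate_le (c := j * (12 * u)) fun e => ih _).trans (le_of_eq ?_)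
    push_cast; ring

/-- The invariant `h` compares `m` with the accumulated value plus the exact counts still to come,
and reserves an error `η` for each remaining level; every level adds `δ` to the failure probability.
-/
theorem success_levels {D u : ℕ} (hD : 1 ≤ D) (hu : 1 ≤ u) (huN : 2 * u < N) {κ δ η tol : ℝ}
    (hκ : 0 < κ) (hδ : 3 / (2 * u ^ 2 * κ ^ 2) ≤ δ) (j : ℕ) (acc : ℝ)
    (hη : ∀ i < j, ((positions n (2 ^ i * D)).card : ℝ) * κ ^ 2 +
      2 * κ * Real.sqrt ((positions n (2 ^ i * D)).card *
        (orderedEdges G (levelRange D i)).card) ≤ η)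
    (h : |acc + ∑ i ∈ Finset.range j, ((orderedEdges G (levelRange D i)).card : ℝ) -
      G.edgeFinset.card| + j * η ≤ tol) :
    1 - j * δ ≤ QProg.success G L init {r : ℝ | |r - G.edgeFinset.card| ≤ tol}
      (levels init z D u j acc) := by
  have hδ0 : 0 ≤ δ := le_trans (by positivity) hδ
  induction j generalizing acc with
  | zero =>
    rw [levels, QProg.success_output]
    · simp
    · simpa using h
  | succ j ih =>
    have h1 := success_estimate (G := G) (L := L) (init := init) (z := z)
      (S := positions n (2 ^ j * D))
      (F := edgeMarker n (levelRange D j)) (next := fun e => levels init z D u j (acc + e))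
      (R := {r : ℝ | |r - G.edgeFinset.card| ≤ tol})
      (positions_nonempty z (Nat.one_le_iff_ne_zero.2 (by positivity))) hu huN hκ hδ
      (w := j * δ) (by positivity) (fun e he => by
        rw [card_filter_edgeMarker G L z _ _ fun d hd => levelRange_le hd] at he
        refine ih _ (fun i hi => hη i (by omega)) (le_trans ?_ h)
        have he' := he.trans (hη j (by omega))
        rw [Finset.sum_range_succ]
        push_cast
        have := abs_add_le (acc + (∑ i ∈ Finset.range j,
          ((orderedEdges G (levelRange D i)).card : ℝ) +
            ((orderedEdges G (levelRange D j)).card : ℝ)) - G.edgeFinset.card)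
          (e - (orderedEdges G (levelRange D j)).card)
        have e1 : acc + (∑ i ∈ Finset.range j,
          ((orderedEdges G (levelRange D i)).card : ℝ) +
            ((orderedEdges G (levelRange D j)).card : ℝ)) - G.edgeFinset.card +
          (e - (orderedEdges G (levelRange D j)).card) = acc + e + ∑ i ∈ Finset.range j,
          ((orderedEdges G (levelRange D i)).card : ℝ) - G.edgeFinset.card := by ring
        rw [e1] at this
        linarith)
    refine le_trans (le_of_eq ?_) h1
    push_cast; ring

/-! ### The rounds -/

/-- Rounding up by `1` costs at most a factor `5`, since `1 ≤ 4 * (n / 4 ^ r)`. -/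
theorem roundDegree_bounds {r : ℕ} (hr : 1 / 4 ≤ (n : ℝ) / 4 ^ r) :
    (n : ℝ) / 4 ^ r ≤ roundDegree n r ∧ (roundDegree n r : ℝ) ≤ 5 * ((n : ℝ) / 4 ^ r) := by
  have h4 : (0 : ℝ) < 4 ^ r := by positivity
  unfold roundDegree
  constructor
  · rw [div_le_iff₀ h4]
    have : n < (n / 4 ^ r + 1) * 4 ^ r := by
      rw [mul_comm]; exact Nat.lt_mul_div_succ n (by positivity)
    exact_mod_cast this.le
  · have : ((n / 4 ^ r : ℕ) : ℝ) ≤ (n : ℝ) / 4 ^ r := by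
      have := Nat.cast_div_le (α := ℝ) (m := n) (n := 4 ^ r)
      simpa using this
    push_cast
    linarith

theorem four_pow_eq (r : ℕ) : (4 : ℝ) ^ r = (2 ^ r) ^ 2 := by
  rw [← pow_mul, mul_comm, pow_mul]; norm_num

theorem card_positions_roundDegree_le {r : ℕ} (hr : 1 / 4 ≤ (n : ℝ) / 4 ^ r) :
    ((positions n (roundDegree n r)).card : ℝ) ≤ 5 * (2 ^ r) ^ 2 * ((n : ℝ) / 4 ^ r) ^ 2 := by
  have h1 : ((positions n (roundDegree n r)).card : ℝ) ≤ n * roundDegree n r := by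
    exact_mod_cast card_positions_le _ _
  have h2 : (n : ℝ) = 4 ^ r * ((n : ℝ) / 4 ^ r) := by field_simp
  refine h1.trans ((mul_le_mul_of_nonneg_left (roundDegree_bounds hr).2 (by positivity)).trans
    (le_of_eq ?_))
  rw [← four_pow_eq]
  nth_rw 1 [h2]
  ring

/-- Here `y ^ 2` is the guess, `f` the truncated degree sum, `s` the number of positions and `t = 2
^ r`. The error is at most `y² / 80 + f / 4`. -/
theorem test_accepts {y f s e t : ℝ} (ht : 0 < t) (hs : s ≤ 5 * t ^ 2 * y ^ 2) (hf : y ^ 2 ≤ f)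
    (he : |e - f| ≤ s * (1 / (20 * t)) ^ 2 + 2 * (1 / (20 * t)) * Real.sqrt (s * f)) :
    y ^ 2 / 2 ≤ e := by
  have hf0 : 0 ≤ f := (sq_nonneg y).trans hf
  have h1 : Real.sqrt (s * f) ≤ 5 / 2 * t * f := by
    rw [Real.sqrt_le_left (by positivity)]
    calc s * f ≤ 5 * t ^ 2 * y ^ 2 * f := by gcongr
      _ ≤ 5 * t ^ 2 * f * f := by gcongr
      _ ≤ (5 / 2 * t * f) ^ 2 := by nlinarith [sq_nonneg (t * f)]
  have h2 : |e - f| ≤ 5 * t ^ 2 * y ^ 2 * (1 / (20 * t)) ^ 2 +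
      2 * (1 / (20 * t)) * (5 / 2 * t * f) := he.trans (by gcongr)
  have h3 : 5 * t ^ 2 * y ^ 2 * (1 / (20 * t)) ^ 2 + 2 * (1 / (20 * t)) * (5 / 2 * t * f) =
      y ^ 2 / 80 + f / 4 := by field_simp; ring
  rw [h3] at h2
  linarith [(abs_le.1 h2).1]

/-- The error is at most `y² / 80 + y² / 10`, so acceptance certifies `f > y² / 8`. -/
theorem test_rejects {y f s e t : ℝ} (ht : 0 < t) (hs : s ≤ 5 * t ^ 2 * y ^ 2) (hf0 : 0 ≤ f)
    (hy : y ≠ 0) (hf : f ≤ y ^ 2 / 8)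
    (he : |e - f| ≤ s * (1 / (20 * t)) ^ 2 + 2 * (1 / (20 * t)) * Real.sqrt (s * f)) :
    ¬ y ^ 2 / 2 ≤ e := by
  have hy2 : 0 < y ^ 2 := by positivity
  have h1 : Real.sqrt (s * f) ≤ t * y ^ 2 := by
    rw [Real.sqrt_le_left (by positivity)]
    calc s * f ≤ 5 * t ^ 2 * y ^ 2 * (y ^ 2 / 8) := by gcongr
      _ ≤ (t * y ^ 2) ^ 2 := by nlinarith [sq_nonneg (t * y ^ 2)]
  have h2 : |e - f| ≤ 5 * t ^ 2 * y ^ 2 * (1 / (20 * t)) ^ 2 +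
      2 * (1 / (20 * t)) * (t * y ^ 2) := he.trans (by gcongr)
  have h3 : 5 * t ^ 2 * y ^ 2 * (1 / (20 * t)) ^ 2 + 2 * (1 / (20 * t)) * (t * y ^ 2) =
      y ^ 2 / 80 + y ^ 2 / 10 := by field_simp; ring
  rw [h3] at h2
  linarith [(abs_le.1 h2).2]

theorem sq_le_truncatedDegreeSum {r : ℕ} (hr : 1 / 4 ≤ (n : ℝ) / 4 ^ r)
    (h : ((n : ℝ) / 4 ^ r) ^ 2 ≤ G.edgeFinset.card) :
    ((n : ℝ) / 4 ^ r) ^ 2 ≤ truncatedDegreeSum G (roundDegree n r) := by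
  rcases le_truncatedDegreeSum G (roundDegree n r) with h1 | h1
  · exact h.trans (Nat.cast_le.2 h1)
  · have h2 : (2 * (roundDegree n r : ℝ) ^ 2) ≤ truncatedDegreeSum G (roundDegree n r) := by
      exact_mod_cast h1
    have h3 := pow_le_pow_left₀ (by positivity) (roundDegree_bounds hr).1 2
    linarith [sq_nonneg (roundDegree n r : ℝ)]

/-- The factor `r + 2` in the window buys summability: these bounds telescope, with sum `1 / (6 (r +
1))` over all rounds from `r` on. -/
theorem testWindow_bound (r : ℕ) :
    3 / (2 * (testWindow r : ℝ) ^ 2 * (1 / (20 * 2 ^ r)) ^ 2) ≤ 1 / (6 * (r + 1) * (r + 2)) := by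
  have h : 3 / (2 * (testWindow r : ℝ) ^ 2 * (1 / (20 * 2 ^ r)) ^ 2) =
      1 / (6 * (r + 2) * (r + 2)) := by
    unfold testWindow; push_cast; field_simp; norm_num
  rw [h]
  gcongr
  linarith

/-- Window times accuracy is `3 J E ε ≥ 3 J`, so a union bound over `J` levels loses at most `1 /
6`. -/
theorem levelWindow_bound {J E r : ℕ} (hJ : 1 ≤ J) {ε : ℝ} (hε : 0 < ε) (hE : 1 ≤ E * ε) :
    3 / (2 * (levelWindow J E r : ℝ) ^ 2 * (ε / (400 * 2 ^ r * J)) ^ 2) ≤ 1 / (6 * J) := by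
  have hJ' : (1 : ℝ) ≤ J := by exact_mod_cast hJ
  have h : 2 * (levelWindow J E r : ℝ) ^ 2 * (ε / (400 * 2 ^ r * J)) ^ 2 =
      18 * J ^ 2 * (E * ε) ^ 2 := by
    unfold levelWindow; push_cast; field_simp; ring
  rw [h, div_le_div_iff₀ (by positivity) (by positivity)]
  have h2 : 1 ≤ (E * ε) ^ 2 := one_le_pow₀ hE
  nlinarith [mul_le_mul_of_nonneg_left h2 (by positivity : (0 : ℝ) ≤ 18 * J ^ 2)]

/-- The error of the estimate of one level. -/
theorem level_error_le {r J : ℕ} {ε m y : ℝ} (hε : 0 < ε) (hJ : 1 ≤ J)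
    {s c : ℝ} (hy : y ^ 2 ≤ 16 * m) (hm : 0 < m)
    (hs : s ≤ 320 * (2 ^ r) ^ 2 * y ^ 2 / ε) (hsc : s * c ≤ 128 * (2 ^ r) ^ 2 * y ^ 2 * m) :
    s * (ε / (400 * 2 ^ r * J)) ^ 2 + 2 * (ε / (400 * 2 ^ r * J)) * Real.sqrt (s * c) ≤
      ε * m / (2 * J) := by
  have hJ' : (1 : ℝ) ≤ J := by exact_mod_cast hJ
  -- `46 ^ 2 = 2116` exceeds `128 * 16 = 2048`.
  have h1 : Real.sqrt (s * c) ≤ 46 * 2 ^ r * m := by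
    rw [Real.sqrt_le_left (by positivity)]
    calc s * c ≤ 128 * (2 ^ r) ^ 2 * y ^ 2 * m := hsc
      _ ≤ 128 * (2 ^ r) ^ 2 * (16 * m) * m := by gcongr
      _ ≤ (46 * 2 ^ r * m) ^ 2 := by nlinarith [sq_nonneg (2 ^ r * m)]
  have h2 : s ≤ 320 * (2 ^ r) ^ 2 * (16 * m) / ε := hs.trans (by gcongr)
  calc _ ≤ 320 * (2 ^ r) ^ 2 * (16 * m) / ε * (ε / (400 * 2 ^ r * J)) ^ 2 +
        2 * (ε / (400 * 2 ^ r * J)) * (46 * 2 ^ r * m) := by gcongr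
    _ = 4 / 125 * (ε * m / J) / J + 23 / 100 * (ε * m / J) := by field_simp; ring
    _ ≤ 4 / 125 * (ε * m / J) + 23 / 100 * (ε * m / J) := by
        gcongr; exact div_le_self (by positivity) hJ'
    _ ≤ (ε * m / J) / 2 := by
        have : 0 ≤ ε * m / J := by positivity
        linarith
    _ = _ := by field_simp

/-- The parameters of the algorithm. -/
structure GoodParameters (N J E n : ℕ) (ε : ℝ) : Prop where
  eps_pos : 0 < ε
  eps_lt_one : ε < 1
  le_mul_eps : 1 ≤ E * ε
  mul_eps_le : E * ε ≤ 2
  le_two_pow : 16 * E ≤ 2 ^ J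
  two_pow_le : 2 ^ J ≤ 32 * E
  test_lt : ∀ r ≤ Nat.clog 4 n, 2 * testWindow r < N
  level_lt : ∀ r ≤ Nat.clog 4 n, 2 * levelWindow (J + 1) E r < N

variable {G L} {J E : ℕ} {ε : ℝ}

/-- When the guess is right up to a factor `16`, half of the tolerance `ε m` covers the dropped
edges of high degree, and the other half is split equally among the `J + 1` levels. -/
theorem success_levels_round (hp : GoodParameters N J E n ε) {r : ℕ} (hrR : r ≤ Nat.clog 4 n)
    (hr : 1 / 4 ≤ (n : ℝ) / 4 ^ r) (hm : 0 < (G.edgeFinset.card : ℝ))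
    (h1 : ((n : ℝ) / 4 ^ r) ^ 2 ≤ 16 * G.edgeFinset.card)
    (h2 : (G.edgeFinset.card : ℝ) ≤ 16 * ((n : ℝ) / 4 ^ r) ^ 2) :
    5 / 6 ≤ QProg.success G L init
      {x : ℝ | |x - G.edgeFinset.card| ≤ ε * G.edgeFinset.card}
      (levels init z (roundDegree n r) (levelWindow (J + 1) E r) (J + 1) 0) := by
  set m : ℝ := (G.edgeFinset.card : ℝ) with hmdef
  set y : ℝ := (n : ℝ) / 4 ^ r with hy
  set D := roundDegree n r with hD
  clear_value m
  have hε := hp.eps_pos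
  have hε1 := hp.eps_lt_one
  have hy0 : 0 < y := by linarith
  obtain ⟨hyD, hDy⟩ := roundDegree_bounds hr
  rw [← hy, ← hD] at hyD hDy
  have hE1 : 1 ≤ E := by
    have := hp.le_mul_eps
    rcases Nat.eq_zero_or_pos E with h | h
    · rw [h] at this; norm_num at this
    · exact h
  have hpow1 : 16 / ε ≤ (2 : ℝ) ^ J := by
    have : (16 * E : ℝ) ≤ 2 ^ J := by exact_mod_cast hp.le_two_pow
    rw [div_le_iff₀ hε]
    nlinarith [hp.le_mul_eps]
  have hpow2 : (2 : ℝ) ^ J ≤ 64 / ε := by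
    have : (2 ^ J : ℝ) ≤ 32 * E := by exact_mod_cast hp.two_pow_le
    rw [le_div_iff₀ hε]
    nlinarith [hp.mul_eps_le]
  have hn : (n : ℝ) = (2 ^ r) ^ 2 * y := by rw [hy, four_pow_eq]; field_simp
  have hcard : ∀ i, ((positions n (2 ^ i * D)).card : ℝ) ≤ (2 ^ r) ^ 2 * y * (2 ^ i * D) := by
    intro i
    rw [← hn]
    exact_mod_cast card_positions_le n (2 ^ i * D)
  have hδ := levelWindow_bound (r := r) (Nat.succ_le_succ (Nat.zero_le J)) hε hp.le_mul_eps
  have hmain := success_levels (tol := ε * m) (η := ε * m / (2 * (J + 1 : ℕ))) G L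
    (init := init) (z := z) (D := D)
    (u := levelWindow (J + 1) E r) (Nat.succ_le_succ (Nat.zero_le _))
    (Nat.one_le_iff_ne_zero.2 (by unfold levelWindow; positivity)) (hp.level_lt r hrR)
    (κ := ε / (400 * 2 ^ r * (J + 1 : ℕ))) (by positivity) hδ (J + 1) 0 ?_ ?_
  · rw [← hmdef] at hmain
    refine le_trans (le_of_eq ?_) hmain
    field_simp
    norm_num
  · intro i hi
    refine level_error_le hε (Nat.succ_le_succ (Nat.zero_le J)) h1 hm ?_ ?_
    · refine (hcard i).trans ?_
      have hi2 : (2 : ℝ) ^ i ≤ 64 / ε :=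
        (pow_le_pow_right₀ one_le_two (by omega)).trans hpow2
      calc (2 ^ r) ^ 2 * y * (2 ^ i * D) ≤ (2 ^ r) ^ 2 * y * (64 / ε * (5 * y)) := by gcongr
        _ = _ := by ring
    · refine (mul_le_mul_of_nonneg_right (hcard i) (Nat.cast_nonneg _)).trans ?_
      suffices h : 2 ^ i * D * ((orderedEdges G (levelRange D i)).card : ℝ) ≤ 128 * y * m by
        calc _ = (2 ^ r) ^ 2 * y * (2 ^ i * D * ((orderedEdges G (levelRange D i)).card : ℝ)) := by
              ring
          _ ≤ (2 ^ r) ^ 2 * y * (128 * y * m) := by gcongr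
          _ = _ := by ring
      cases i with
      | zero =>
        have : ((orderedEdges G (levelRange D 0)).card : ℝ) ≤ m := by
          rw [hmdef]
          exact_mod_cast card_orderedEdges_le G _
        have hc0 : (0 : ℝ) ≤ ((orderedEdges G (levelRange D 0)).card : ℝ) := Nat.cast_nonneg _
        generalize ((orderedEdges G (levelRange D 0)).card : ℝ) = c at this hc0 ⊢
        calc 2 ^ 0 * (D : ℝ) * c
            ≤ 2 ^ 0 * (5 * y) * m := by gcongr
          _ ≤ _ := by nlinarith [mul_pos hy0 hm]
      | succ i =>
        -- Degrees in this range are at least half the number of positions per vertex, so the decay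
        -- of the edge count pays for the longer lists.
        have h3 : ((2 ^ i * D : ℕ) : ℝ) ^ 2 * ((orderedEdges G (levelRange D (i + 1))).card : ℝ)
            ≤ 4 * m ^ 2 := by
          rw [hmdef]
          exact_mod_cast sq_mul_card_orderedEdges_le G (levelRange D (i + 1)) (2 ^ i * D)
            fun d hd => hd.1
        push_cast at h3
        have hK : y ≤ 2 ^ i * D := hyD.trans (le_mul_of_one_le_left (by positivity)
          (one_le_pow₀ one_le_two))
        generalize ((orderedEdges G (levelRange D (i + 1))).card : ℝ) = c at h3 ⊢
        have h4 : (2 ^ i * D) * ((2 ^ i * D) * c) ≤ (2 ^ i * D) * (64 * y * m) := by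
          calc (2 ^ i * D) * ((2 ^ i * D) * c) = (2 ^ i * D) ^ 2 * c := by ring
            _ ≤ 4 * m ^ 2 := h3
            _ ≤ 4 * m * (16 * y ^ 2) := by nlinarith
            _ = y * (64 * y * m) := by ring
            _ ≤ _ := by gcongr
        have h5 := le_of_mul_le_mul_left h4 (by linarith)
        calc _ = 2 * (2 ^ i * D * c) := by ring
          _ ≤ 2 * (64 * y * m) := by linarith
          _ = _ := by ring
  · have h3 := card_orderedEdges_add_not G fun d => d < 2 ^ J * D
    rw [← sum_card_levelRange G D J] at h3
    have h4 : ((2 ^ J * D : ℕ) : ℝ) ^ 2 *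
        ((orderedEdges G fun d => ¬ d < 2 ^ J * D).card : ℝ) ≤ 4 * m ^ 2 := by
      rw [hmdef]
      exact_mod_cast sq_mul_card_orderedEdges_le G (fun d => ¬ d < 2 ^ J * D) (2 ^ J * D)
        fun d hd => not_lt.1 hd
    have h5 : (∑ i ∈ Finset.range (J + 1), ((orderedEdges G (levelRange D i)).card : ℝ)) +
        ((orderedEdges G fun d => ¬ d < 2 ^ J * D).card : ℝ) = m := by
      rw [hmdef]; exact_mod_cast h3
    have hc0 : (0 : ℝ) ≤ ((orderedEdges G fun d => ¬ d < 2 ^ J * D).card : ℝ) :=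
      Nat.cast_nonneg _
    push_cast at h4
    generalize ((orderedEdges G fun d => ¬ d < 2 ^ J * D).card : ℝ) = c at h4 h5 hc0
    -- In fact `c ≤ ε² m / 4`, from `4 m² / (16 y / ε)²` and `m ≤ 16 y²`.
    have h6 : c ≤ ε * m / 2 := by
      have hK : 16 / ε * y ≤ 2 ^ J * D := by gcongr
      have h7 : (16 / ε * y) ^ 2 * c ≤ 4 * m ^ 2 :=
        (mul_le_mul_of_nonneg_right (pow_le_pow_left₀ (by positivity) hK 2) hc0).trans h4
      have h8 : (16 / ε * y) ^ 2 * c ≤ (16 / ε * y) ^ 2 * (ε ^ 2 * m / 4) := by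
        calc _ ≤ 4 * m ^ 2 := h7
          _ ≤ 4 * m * (16 * y ^ 2) := by nlinarith
          _ = _ := by field_simp; ring
      have h9 := le_of_mul_le_mul_left h8 (by positivity)
      nlinarith [mul_pos hε hm, mul_lt_mul_of_pos_right hε1 (mul_pos hε hm)]
    have h10 : 0 + ∑ i ∈ Finset.range (J + 1), ((orderedEdges G (levelRange D i)).card : ℝ) - m
        = -c := by linarith
    rw [← hmdef, h10, abs_neg, abs_of_nonneg hc0]
    have h11 : ((J + 1 : ℕ) : ℝ) * (ε * m / (2 * (J + 1 : ℕ))) = ε * m / 2 := by field_simp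
    rw [h11]
    linarith

end Algorithm

/-! ### Success probability and expected cost of the rounds. -/

section Analysis

variable {n N : ℕ} [NeZero N] {G : SimpleGraph (Fin n)} [DecidableRel G.Adj] {L : NeighborOrder G}
  {init : BasisLabel n (Workspace n N)} {z : Fin n} {J E : ℕ} {ε : ℝ}

theorem quarter_le_div {r : ℕ} (hn : 1 ≤ n) (hr : r ≤ Nat.clog 4 n) :
    1 / 4 ≤ (n : ℝ) / 4 ^ r := by
  cases r with
  | zero =>
    have : (1 : ℝ) ≤ n := by exact_mod_cast hn
    simp; linarith
  | succ r =>
    have h : 4 ^ r < n := (Nat.lt_clog_iff_pow_lt (by norm_num)).1 hr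
    have h' : (4 : ℝ) ^ r ≤ n := by exact_mod_cast h.le
    rw [le_div_iff₀ (by positivity), pow_succ]
    linarith

theorem sq_div_four_pow (r : ℕ) : ((n : ℝ) / 4 ^ r) ^ 2 = n ^ 2 / 16 ^ r := by
  rw [div_pow, ← pow_mul, mul_comm, pow_mul]; norm_num

theorem card_edgeFinset_le_sq : G.edgeFinset.card ≤ n ^ 2 := by
  rw [← card_orderedEdges_true]
  refine (Finset.card_le_univ _).trans (le_of_eq ?_)
  simp [sq]

/-- In the round in which the guess is small enough, accurate estimates are accepted. -/
theorem accepts_of_sq_le {r : ℕ} (hr : 1 / 4 ≤ (n : ℝ) / 4 ^ r)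
    (h : ((n : ℝ) / 4 ^ r) ^ 2 ≤ G.edgeFinset.card) {e : ℝ}
    (he : |e - truncatedDegreeSum G (roundDegree n r)| ≤
      (positions n (roundDegree n r)).card * (1 / (20 * 2 ^ r)) ^ 2 + 2 * (1 / (20 * 2 ^ r)) *
        Real.sqrt ((positions n (roundDegree n r)).card *
          truncatedDegreeSum G (roundDegree n r))) :
    ((n : ℝ) / 4 ^ r) ^ 2 / 2 ≤ e :=
  test_accepts (by positivity) (card_positions_roundDegree_le hr)
    (sq_le_truncatedDegreeSum G hr h) he

/-- `hmin` records that the guesses of earlier rounds exceeded `m`. The failure budget is the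
telescoped `1 / (6 (r + 1))` for the tests still to come, plus `1 / 6` for the levels, which are run
at most once. -/
theorem success_rounds (hp : GoodParameters N J E n ε) (fuel r : ℕ)
    (hfr : r + fuel = Nat.clog 4 n + 1)
    (hmin : G.edgeFinset.card ≠ 0 → ∀ r' < r, G.edgeFinset.card * 16 ^ r' < n ^ 2) :
    1 - (1 / (6 * (r + 1 : ℝ)) + 1 / 6) ≤ QProg.success G L init
      {x : ℝ | |x - G.edgeFinset.card| ≤ ε * G.edgeFinset.card}
      (rounds init z (J + 1) E fuel r) := by
  classical
  induction fuel generalizing r with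
  | zero =>
    -- Running out of rounds is correct for an edgeless graph; otherwise the last guess is at most
    -- `1`, against `hmin`.
    by_cases hm : G.edgeFinset.card = 0
    · rw [rounds, QProg.success_output (by simp [hm])]
      have : (0 : ℝ) ≤ 1 / (6 * (r + 1 : ℝ)) := by positivity
      linarith
    · exfalso
      have h1 := hmin hm (Nat.clog 4 n) (by omega)
      have h2 : n ≤ 4 ^ Nat.clog 4 n := Nat.le_pow_clog (by norm_num) n
      have h3 : n ^ 2 ≤ 16 ^ Nat.clog 4 n := by
        calc n ^ 2 ≤ (4 ^ Nat.clog 4 n) ^ 2 := Nat.pow_le_pow_left h2 2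
          _ = 16 ^ Nat.clog 4 n := by rw [← pow_mul, mul_comm, pow_mul]; norm_num
      have h4 := Nat.le_mul_of_pos_left (16 ^ Nat.clog 4 n) (Nat.pos_of_ne_zero hm)
      omega
  | succ fuel ih =>
    have hrR : r ≤ Nat.clog 4 n := by omega
    have hr := quarter_le_div z.pos hrR
    have hw : (0 : ℝ) ≤ 1 / (6 * ((r + 1 : ℕ) + 1 : ℝ)) + 1 / 6 := by positivity
    have key := success_estimate (G := G) (L := L) (init := init) (z := z)
      (S := positions n (roundDegree n r)) (F := degreeMarker n)
      (next := fun e => if ((n : ℝ) / 4 ^ r) ^ 2 / 2 ≤ e then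
          levels init z (roundDegree n r) (levelWindow (J + 1) E r) (J + 1) 0
        else rounds init z (J + 1) E fuel (r + 1))
      (R := {x : ℝ | |x - G.edgeFinset.card| ≤ ε * G.edgeFinset.card})
      (positions_nonempty z (Nat.succ_le_succ (Nat.zero_le _)))
      (u := testWindow r) (Nat.one_le_iff_ne_zero.2 (by unfold testWindow; positivity))
      (hp.test_lt r hrR) (κ := 1 / (20 * 2 ^ r)) (by positivity) (testWindow_bound r) hw ?_
    · refine le_trans (le_of_eq ?_) key
      push_cast
      field_simp
      ring
    · intro e he
      rw [card_filter_degreeMarker] at he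
      have hwle : 1 - (1 / (6 * ((r + 1 : ℕ) + 1 : ℝ)) + 1 / 6) ≤ 5 / 6 := by
        have : (0 : ℝ) ≤ 1 / (6 * ((r + 1 : ℕ) + 1 : ℝ)) := by positivity
        linarith
      split_ifs with hacc
      -- Acceptance bounds the guess by `16 m`; the converse comes from the previous round, or from
      -- `m ≤ n²` in round `0`.
      · have hf : ((n : ℝ) / 4 ^ r) ^ 2 / 8 < truncatedDegreeSum G (roundDegree n r) := by
          by_contra hlt
          exact test_rejects (by positivity) (card_positions_roundDegree_le hr)
            (Nat.cast_nonneg _) (by linarith) (not_lt.1 hlt) he hacc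
        have hf2 : (truncatedDegreeSum G (roundDegree n r) : ℝ) ≤ 2 * G.edgeFinset.card := by
          exact_mod_cast truncatedDegreeSum_le G _
        have hm : 0 < (G.edgeFinset.card : ℝ) := by
          have : 0 ≤ ((n : ℝ) / 4 ^ r) ^ 2 := sq_nonneg _
          linarith
        refine hwle.trans (success_levels_round hp hrR hr hm (by linarith) ?_)
        cases r with
        | zero =>
          have : (G.edgeFinset.card : ℝ) ≤ (n : ℝ) ^ 2 := by exact_mod_cast card_edgeFinset_le_sq
          simp
          linarith [sq_nonneg (n : ℝ)]
        | succ r =>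
          have h1 := hmin (Nat.cast_ne_zero.1 hm.ne') r (by omega)
          have h2 : (G.edgeFinset.card : ℝ) * 16 ^ r ≤ (n : ℝ) ^ 2 := by exact_mod_cast h1.le
          rw [sq_div_four_pow, pow_succ (16 : ℝ) r, ← mul_div_assoc, le_div_iff₀ (by positivity)]
          linarith
      · refine ih (r + 1) (by omega) fun hm r' hr' => ?_
        rcases Nat.lt_succ_iff_lt_or_eq.1 hr' with h | rfl
        · exact hmin hm r' h
        · by_contra hlt
          refine hacc (accepts_of_sq_le hr ?_ he)
          rw [sq_div_four_pow, div_le_iff₀ (by positivity)]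
          exact_mod_cast not_lt.1 hlt

/-- A bound on the number of queries in round `r`. -/
noncomputable def roundCost (J E r : ℕ) : ℝ := 12 * testWindow r + J * (12 * levelWindow J E r)

theorem roundCost_nonneg (J E r : ℕ) : 0 ≤ roundCost J E r := by unfold roundCost; positivity

theorem roundCost_succ_le (J E r : ℕ) : roundCost J E (r + 1) ≤ 4 * roundCost J E r := by
  unfold roundCost testWindow levelWindow
  push_cast
  rw [pow_succ]
  have h1 : (0 : ℝ) ≤ 2 ^ r := by positivity
  have h2 : (0 : ℝ) ≤ r * 2 ^ r := by positivity
  have h3 : (0 : ℝ) ≤ 2 ^ r * J ^ 3 * E := by positivity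
  nlinarith

theorem roundCost_mono (J E : ℕ) {r s : ℕ} (h : r ≤ s) : roundCost J E r ≤ roundCost J E s := by
  unfold roundCost testWindow levelWindow
  have h2 : (2 : ℕ) ^ r ≤ 2 ^ s := Nat.pow_le_pow_right (by norm_num) h
  gcongr

/-- Test, levels and later rounds are all charged, as if every branch were executed; no probability
is involved. -/
theorem queries_rounds_le (J E fuel r : ℕ) {c : ℝ}
    (hc : QProg.queries G L init (rounds init z J E fuel (r + 1)) ≤ c) :
    QProg.queries G L init (rounds init z J E (fuel + 1) r) ≤ roundCost J E r + c := by
  have hc0 : 0 ≤ c := (QProg.queries_nonneg _ _).trans hc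
  have h := queries_estimate_le (G := G) (L := L) (init := init) (z := z)
    (S := positions n (roundDegree n r)) (F := degreeMarker n) (u := testWindow r)
    (next := fun e => if ((n : ℝ) / 4 ^ r) ^ 2 / 2 ≤ e then
          levels init z (roundDegree n r) (levelWindow J E r) J 0
        else rounds init z J E fuel (r + 1)) (c := J * (12 * levelWindow J E r) + c)
    (fun e => by
      have h1 : (0 : ℝ) ≤ J * (12 * levelWindow J E r) := by positivity
      split_ifs
      · exact (queries_levels_le G L _ _ _ _).trans (by linarith)
      · linarith)
  refine h.trans (le_of_eq ?_)
  rw [roundCost]; ring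

/-- Once the guess is small enough, the number of queries does not grow any more. -/
theorem queries_rounds_late (hp : GoodParameters N J E n ε) (fuel r : ℕ)
    (hfr : r + fuel = Nat.clog 4 n + 1)
    (hr0 : n ^ 2 ≤ max G.edgeFinset.card 1 * 16 ^ r) :
    QProg.queries G L init (rounds init z (J + 1) E fuel r) ≤ 2 * roundCost (J + 1) E r := by
  classical
  induction fuel generalizing r with
  | zero =>
    rw [rounds, QProg.queries_output]
    linarith [roundCost_nonneg (J + 1) E r]
  | succ fuel ih =>
    have hrR : r ≤ Nat.clog 4 n := by omega
    have hr := quarter_le_div z.pos hrR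
    have hc := roundCost_nonneg (J + 1) E r
    -- Without edges no test need accept, but then `n ≤ 4 ^ r`, and this is the last round.
    by_cases hm : G.edgeFinset.card = 0
    · have h1 : n ^ 2 ≤ (4 ^ r) ^ 2 := by
        rw [hm] at hr0
        calc n ^ 2 ≤ 16 ^ r := by simpa using hr0
          _ = (4 ^ r) ^ 2 := by rw [← pow_mul, mul_comm, pow_mul]; norm_num
      have h2 : Nat.clog 4 n ≤ r :=
        Nat.clog_le_of_le_pow ((Nat.pow_le_pow_iff_left two_ne_zero).1 h1)
      obtain rfl : fuel = 0 := by omega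
      refine (queries_rounds_le (c := 0) _ _ _ _ ?_).trans (by linarith)
      rw [rounds, QProg.queries_output]
    · have hmax : max G.edgeFinset.card 1 = G.edgeFinset.card := by omega
      have hsq : ((n : ℝ) / 4 ^ r) ^ 2 ≤ G.edgeFinset.card := by
        rw [sq_div_four_pow, div_le_iff₀ (by positivity)]
        rw [hmax] at hr0
        exact_mod_cast hr0
      have hnext := ih (r + 1) (by omega) (hr0.trans (Nat.mul_le_mul_left _
        (Nat.pow_le_pow_right (by norm_num) r.le_succ)))
      have hc1 : 0 ≤ 2 * roundCost (J + 1) E (r + 1) := by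
        linarith [roundCost_nonneg (J + 1) E (r + 1)]
      have hl0 : (0 : ℝ) ≤ (J + 1 : ℕ) * (12 * levelWindow (J + 1) E r) := by positivity
      have hlev := queries_levels_le G L (init := init) (z := z) (roundDegree n r)
        (levelWindow (J + 1) E r) (J + 1) 0
      have key := queries_estimate (G := G) (L := L) (init := init) (z := z)
        (S := positions n (roundDegree n r)) (F := degreeMarker n)
        (next := fun e => if ((n : ℝ) / 4 ^ r) ^ 2 / 2 ≤ e then
            levels init z (roundDegree n r) (levelWindow (J + 1) E r) (J + 1) 0
          else rounds init z (J + 1) E fuel (r + 1))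
        (positions_nonempty z (Nat.succ_le_succ (Nat.zero_le _)))
        (u := testWindow r) (Nat.one_le_iff_ne_zero.2 (by unfold testWindow; positivity))
        (hp.test_lt r hrR) (κ := 1 / (20 * 2 ^ r)) (by positivity)
        -- The later rounds cost at most `2 * 4` times `roundCost` of this one, and `8 / 12 < 1`
        -- closes the induction.
        ((testWindow_bound r).trans (show _ ≤ (1 : ℝ) / 12 by
          have : (0 : ℝ) ≤ r := Nat.cast_nonneg _
          gcongr
          nlinarith)) (c₀ := (J + 1 : ℕ) * (12 * levelWindow (J + 1) E r)) hc1
        (fun e he => by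
          rw [card_filter_degreeMarker] at he
          rw [if_pos (accepts_of_sq_le hr hsq he)]
          exact hlev)
        (fun e => by
          split_ifs
          · linarith
          · linarith)
      have hgrow := roundCost_succ_le (J + 1) E r
      refine key.trans ?_
      have hdef : roundCost (J + 1) E r =
        12 * testWindow r + (J + 1 : ℕ) * (12 * levelWindow (J + 1) E r) := rfl
      linarith

/-- Each round before `s` is charged in full, at the price of round `s`; the rounds from `s` on cost
twice that price in expectation. -/
theorem queries_rounds (hp : GoodParameters N J E n ε) (fuel r s : ℕ)
    (hfr : r + fuel = Nat.clog 4 n + 1)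
    (hs : n ^ 2 ≤ max G.edgeFinset.card 1 * 16 ^ s) (hrs : r ≤ s) :
    QProg.queries G L init (rounds init z (J + 1) E fuel r) ≤
      (s - r + 2) * roundCost (J + 1) E s := by
  induction fuel generalizing r with
  | zero =>
    rw [rounds, QProg.queries_output]
    have : (r : ℝ) ≤ s := Nat.cast_le.2 hrs
    exact mul_nonneg (by linarith) (roundCost_nonneg _ _ _)
  | succ fuel ih =>
    rcases hrs.eq_or_lt with rfl | hlt
    · exact (queries_rounds_late hp _ _ hfr hs).trans (le_of_eq (by ring))
    · refine (queries_rounds_le _ _ _ _ (ih (r + 1) (by omega) hlt)).trans ?_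
      have := roundCost_mono (J + 1) E hrs
      push_cast
      linarith

end Analysis

/-! ## The main theorem -/

/-- The parameters of the algorithm can be chosen of logarithmic size. -/
theorem exists_goodParameters (n : ℕ) {ε : ℝ} (h0 : 0 < ε) (h1 : ε < 1) :
    ∃ N J E : ℕ, N ≠ 0 ∧ GoodParameters N J E n ε := by
  set E := ⌈1 / ε⌉₊ with hE
  set J := Nat.clog 2 (16 * E) with hJ
  have hE1 : 1 ≤ E * ε := by
    rw [← div_le_iff₀ h0]; exact Nat.le_ceil _
  have hE2 : E * ε ≤ 2 := by
    have : (E : ℝ) < 1 / ε + 1 := Nat.ceil_lt_add_one (by positivity)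
    calc E * ε ≤ (1 / ε + 1) * ε := by gcongr
      _ = 1 + ε := by field_simp
      _ ≤ 2 := by linarith
  have hE0 : 1 ≤ E := Nat.one_le_ceil_iff.2 (by positivity)
  have hJ1 : 1 ≤ J := (Nat.lt_clog_iff_pow_lt (by norm_num)).2 (by simp; omega)
  refine ⟨2 * (testWindow (Nat.clog 4 n) + levelWindow (J + 1) E (Nat.clog 4 n)) + 1, J, E,
    by omega, h0, h1, hE1, hE2, Nat.le_pow_clog (by norm_num) _, ?_, ?_, ?_⟩
  · have h : 2 ^ (J - 1) < 16 * E := (Nat.lt_clog_iff_pow_lt (by norm_num)).1 (by omega)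
    obtain ⟨K, hK⟩ : ∃ K, J = K + 1 := ⟨J - 1, by omega⟩
    rw [hK] at h ⊢
    rw [pow_succ]
    simp only [Nat.add_sub_cancel] at h
    omega
  · intro r hr
    have : testWindow r ≤ testWindow (Nat.clog 4 n) := by
      unfold testWindow
      gcongr
      norm_num
    omega
  · intro r hr
    have : levelWindow (J + 1) E r ≤ levelWindow (J + 1) E (Nat.clog 4 n) := by
      unfold levelWindow
      gcongr
      norm_num
    omega

theorem le_log_of_two_pow_le {k : ℕ} {a x : ℝ} (hx : 0 < x) (ha : 0 < a) (h : (2 : ℝ) ^ k ≤ a * x) :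
    k * Real.log 2 ≤ Real.log a + Real.log x := by
  rw [← Real.log_pow, ← Real.log_mul ha.ne' hx.ne']
  exact Real.log_le_log (by positivity) h

/-- The number of rounds and the number of queries in each of them, in terms of the rate. -/
theorem roundCost_le {J E n m s : ℕ} {ε : ℝ} {N : ℕ} (hp : GoodParameters N J E n ε) (hn : 1 ≤ n)
    (hmn : max m 1 ≤ n ^ 2) (hs : ∀ r < s, max m 1 * 16 ^ r < n ^ 2) :
    (s + 2) * roundCost (J + 1) E s ≤ 10 ^ 9 *
      (edgeRate n m ε * (1 + Real.log (edgeRate n m ε)) ^ 4) := by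
  have hε := hp.eps_pos
  have hε1 := hp.eps_lt_one
  set x := edgeRate n m ε with hx
  set X : ℝ := (n : ℝ) ^ (1 / 2 : ℝ) / (max m 1 : ℝ) ^ (1 / 4 : ℝ) with hX
  have hn0 : (0 : ℝ) < n := by exact_mod_cast hn
  have hM0 : (0 : ℝ) < (max m 1 : ℝ) := lt_max_of_lt_right one_pos
  have hxX : x = X / ε := by rw [hx, hX, edgeRate, div_div, mul_comm ε]
  have hX0 : 0 < X := by positivity
  have hX4 : X ^ 4 * (max m 1 : ℝ) = (n : ℝ) ^ 2 := by
    rw [hX, div_pow, ← Real.rpow_natCast, ← Real.rpow_natCast, ← Real.rpow_mul hn0.le,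
      ← Real.rpow_mul hM0.le]
    norm_num
    field_simp
  have hcast : ((max m 1 : ℕ) : ℝ) = (max m 1 : ℝ) := by push_cast; rfl
  have hX1 : 1 ≤ X := by
    have h : (max m 1 : ℝ) ≤ (n : ℝ) ^ 2 := by rw [← hcast]; exact_mod_cast hmn
    rw [← hX4] at h
    by_contra hlt
    have : X ^ 4 < 1 := pow_lt_one₀ hX0.le (not_le.1 hlt) (by norm_num)
    nlinarith
  -- The guess of round `s - 1` still exceeds `max m 1`, which gives `16 ^ (s - 1) ≤ X ^ 4`.
  have h2s : (2 : ℝ) ^ s ≤ 2 * X := by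
    cases s with
    | zero => simp; linarith
    | succ s =>
      have h : (max m 1 : ℝ) * 16 ^ s ≤ (n : ℝ) ^ 2 := by
        rw [← hcast]; exact_mod_cast (hs s (Nat.lt_succ_self s)).le
      rw [← hX4, mul_comm] at h
      have h2 := le_of_mul_le_mul_right h hM0
      have h3 : ((2 : ℝ) ^ s) ^ 4 ≤ X ^ 4 := by
        rw [← pow_mul, mul_comm, pow_mul]; norm_num; exact h2
      rw [pow_succ]
      linarith [le_of_pow_le_pow_left₀ (by norm_num) hX0.le h3]
  have hXx : X ≤ x := by rw [hxX]; exact le_div_self hX0.le hε hε1.le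
  have hx1 : 1 ≤ x := hX1.trans hXx
  have hx0 : 0 < x := by linarith
  have hεx : 1 / ε ≤ x := by rw [hxX]; gcongr
  have hlog : 0 ≤ Real.log x := Real.log_nonneg hx1
  have hlog2 := Real.log_two_gt_d9
  set l := 1 + Real.log x with hl
  have hl1 : 1 ≤ l := by linarith
  have hsl : (s : ℝ) + 2 ≤ 4 * l := by
    have h := le_log_of_two_pow_le hx0 two_pos (h2s.trans (by linarith : 2 * X ≤ 2 * x))
    have : (s : ℝ) ≤ 1 + 2 * Real.log x := by
      by_contra hlt
      nlinarith
    linarith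
  have hJl : ((J + 1 : ℕ) : ℝ) ≤ 7 * l := by
    have h1 : (2 : ℝ) ^ J ≤ 2 ^ 6 * x := by
      have h3 : (2 : ℝ) ^ J ≤ 32 * E := by exact_mod_cast hp.two_pow_le
      have h4 : (E : ℝ) ≤ 2 * (1 / ε) := by
        rw [mul_one_div, le_div_iff₀ hε]; exact hp.mul_eps_le
      linarith
    have h := le_log_of_two_pow_le hx0 (by norm_num) h1
    rw [Real.log_pow] at h
    push_cast at h ⊢
    have : (J : ℝ) ≤ 6 + 2 * Real.log x := by
      by_contra hlt
      nlinarith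
    linarith
  have hXE : X * E ≤ 2 * x := by
    rw [hxX, ← mul_div_assoc, le_div_iff₀ hε]
    nlinarith [hp.mul_eps_le]
  have hc : roundCost (J + 1) E s ≤ 24696000 * (x * l ^ 3) := by
    unfold roundCost testWindow levelWindow
    push_cast at hJl ⊢
    have hl3 : l ≤ l ^ 3 := le_self_pow₀ hl1 (by norm_num)
    have a1 : 12 * (60 * (2 : ℝ) ^ s * (s + 2)) ≤ 5760 * (x * l ^ 3) := by
      calc 12 * (60 * (2 : ℝ) ^ s * (s + 2)) ≤ 12 * (60 * (2 * x) * (4 * l ^ 3)) := by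
            gcongr <;> linarith
        _ = _ := by ring
    have a2 : ((J : ℝ) + 1) * (12 * (1200 * 2 ^ s * (J + 1) ^ 2 * E)) ≤
        19756800 * (x * l ^ 3) := by
      calc ((J : ℝ) + 1) * (12 * (1200 * 2 ^ s * (J + 1) ^ 2 * E))
          = 14400 * (J + 1) ^ 3 * (2 ^ s * E) := by ring
        _ ≤ 14400 * (7 * l) ^ 3 * (2 * X * E) := by gcongr
        _ = 14400 * (7 * l) ^ 3 * (2 * (X * E)) := by ring
        _ ≤ 14400 * (7 * l) ^ 3 * (2 * (2 * x)) := by gcongr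
        _ = _ := by ring
    have a3 : 0 ≤ x * l ^ 3 := by positivity
    linarith
  calc (s + 2) * roundCost (J + 1) E s ≤ (4 * l) * (24696000 * (x * l ^ 3)) := by
        gcongr
        exact roundCost_nonneg _ _ _
    _ = 98784000 * (x * l ^ 4) := by ring
    _ ≤ _ := by
        have : 0 ≤ x * l ^ 4 := by positivity
        linarith

theorem mainTheorem9 :
    ∃ (C : ℝ) (c : ℕ), ∀ (n : ℕ) (ε : ℝ), 1 ≤ n → 0 < ε → ε < 1 →
      ∃ A : QueryAlgorithm n, A.prog.PairFree ∧
        ∀ (G : SimpleGraph (Fin n)) [DecidableRel G.Adj] (L : NeighborOrder G),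
          2 / 3 ≤ A.probOutput G L
              {r : ℝ | |r - (G.edgeFinset.card : ℝ)| ≤ ε * (G.edgeFinset.card : ℝ)} ∧
          A.expectedQueries G L ≤
            C * (edgeRate n G.edgeFinset.card ε *
              (1 + Real.log (edgeRate n G.edgeFinset.card ε)) ^ c) := by
  -- Of the four logarithms, one is the number of rounds; the other three come from the levels,
  -- whose number is logarithmic and whose window contains the square of that number.
  refine ⟨10 ^ 9, 4, fun n ε hn h0 h1 => ?_⟩
  obtain ⟨N, J, E, hN, hp⟩ := exists_goodParameters n h0 h1
  have : NeZero N := ⟨hN⟩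
  obtain ⟨z⟩ : Nonempty (Fin n) := ⟨⟨0, hn⟩⟩
  obtain ⟨init⟩ : Nonempty (BasisLabel n (Workspace n N)) := ⟨cleanLabel z 0 (z, z)⟩
  obtain ⟨T, hT⟩ : ∃ T, T = Nat.clog 4 n + 1 := ⟨_, rfl⟩
  refine ⟨⟨Workspace n N, init, rounds init z (J + 1) E T 0⟩, pairFree_rounds init z (J + 1) E T 0,
    fun G _ L => ⟨?_, ?_⟩⟩
  · have h := success_rounds (G := G) (L := L) (init := init) (z := z) hp T 0
      (by omega) (fun _ r' hr' => absurd hr' (Nat.not_lt_zero _))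
    rw [QueryAlgorithm.probOutput, QueryAlgorithm.initState_eq]
    refine le_trans ?_ h
    norm_num
  · have hex : ∃ s, n ^ 2 ≤ max G.edgeFinset.card 1 * 16 ^ s := by
      refine ⟨n, ?_⟩
      have h2 : n < 4 ^ n := Nat.lt_pow_self (by norm_num)
      calc n ^ 2 ≤ (4 ^ n) ^ 2 := Nat.pow_le_pow_left h2.le 2
        _ = 16 ^ n := by rw [← pow_mul, mul_comm, pow_mul]; norm_num
        _ ≤ _ := Nat.le_mul_of_pos_left _ (by omega)
    classical
    rw [QueryAlgorithm.expectedQueries, QueryAlgorithm.initState_eq]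
    -- The first round whose guess is at most `max m 1`; it depends on `G` and enters only the
    -- analysis.
    refine (queries_rounds (G := G) (L := L) (init := init) (z := z) hp T 0
      (Nat.find hex) (by omega) (Nat.find_spec hex) (Nat.zero_le _)).trans ?_
    simp only [Nat.cast_zero, sub_zero]
    refine roundCost_le hp hn ?_ fun r hr => not_le.1 (Nat.find_min hex hr)
    exact max_le card_edgeFinset_le_sq (Nat.one_le_pow _ _ hn)
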